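/- Let $G=\mathrm{SU}_2\times\mathrm{SU}_2$, let $H\subset G$ be the diagonal subgroup, acting by the adjoint representation on $V=\mathfrak{su}_2\cong\mathfrak h$ (via $X\leftrightarrow(X,X)$), and let $M=G\times_H V$ with the natural left action of $G$. In $\mathfrak{su}_2$ fix $$\mathbf h=\tfrac12\begin{pmatrix} i&0\\0&-i\end{pmatrix},\qquad E=\tfrac1{2\sqrt2}\begin{pmatrix}0&1\\-1&0\end{pmatrix},\qquad W=[\mathbf h,E],$$ and put $A=(\mathbf h,-\mathbf h)$, $E_1=(E,0)$, $V_1=(W,0)$, $E_2=(0,E)$, $V_2=(0,W)$ in $\mathfrak{su}_2\oplus\mathfrak{su}_2$. Let $\gamma_t=[(e,t\mathbf h)]\in M$ for $t\in\mathbb R$, let $\xi=\gamma_t'$, and let $S=G\cdot\gamma_0=\{[(g,0)]\}\cong S^3$ be the singular orbit. For $X\in\mathfrak{su}_2\oplus\mathfrak{su}_2$ let $\hat X_p=\frac{d}{ds}\big|_{s=0}\exp(sX)\cdot p$. For $t\neq0$ the vectors $(\xi,\hat A,\hat E_1,\hat V_1,\hat E_2,\hat V_2)$ form a basis of $T_{\gamma_t}M$;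 let $(\xi^*,A^*,E_1^*,V_1^*,E_2^*,V_2^*)$ be the dual basis and $$\omega^1_t=\xi^*\wedge A^*,\quad \omega^2_t=E_1^*\wedge V_1^*,\quad \omega^3_t=E_2^*\wedge V_2^*,\quad \omega^4_t=E_1^*\wedge E_2^*+V_1^*\wedge V_2^*,\quad \omega^5_t=E_1^*\wedge V_2^*-V_1^*\wedge E_2^*.$$ Let $\omega$ be a smooth $G$-invariant $2$-form on $M\setminus S$, and let $f_1,\dots,f_5$ be the functions on $\mathbb R\setminus\{0\}$ with $\omega_{\gamma_t}=\sum_{i=1}^5 f_i(t)\,\omega^i_t$ for all $t\ne0$. Then $\omega$ extends to a smooth $2$-form on $M$ if and only if all $f_i$ extend to smooth functions on $\mathbb R$ such that, writing $\alpha_i=f_i(0)$ and $\beta_i=f_i'(0)$ for the extended functions, (i) $f_1,f_4$ are even and $f_2,f_3,f_5$ are odd; in particular $\alpha_2=\alpha_3=\alpha_5=0$; (ii) $\beta_3=\tfrac12\alpha_1+\beta_2$, $\ \beta_5=-\tfrac14\alpha_1-\beta_2$, $\ \alpha_4=0$. Moreover, if $\omega$ extends smoothly to $M$, then the extended form satisfies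 $(\omega_{\gamma_0})^3\neq0$ if and only if $\alpha_1\ne0$; likewise, the extended form is nondegenerate at every point of $S$ if and only if $\alpha_1\neq0$. -/

import Mathlib

set_option maxSynthPendingDepth 3

open Quaternion Metric
open scoped Manifold ContDiff Bundle

noncomputable section

namespace CohomOne

/-! ### The group `SU₂`, its Lie algebra, and `G = SU₂ × SU₂` -/

instance finrank_quaternion_fact : Fact (Module.finrank ℝ ℍ[ℝ] = 3 + 1) :=
  ⟨Quaternion.finrank_eq_four⟩

/-- `SU₂`, realized in the standard way as the Lie group of unit quaternions
(`i ↦ diag(i,-i)`, `j ↦ [[0,1],[-1,0]]`, `k ↦ [[0,i],[i,0]]`), with the smooth structure of the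
unit sphere `S³ ⊂ ℍ = ℝ⁴`. -/
abbrev SU2 : Type := sphere (0 : ℍ[ℝ]) 1

/-- The group `G = SU₂ × SU₂`. -/
abbrev G : Type := SU2 × SU2

/-- The Lie algebra `𝔰𝔲₂`: the imaginary quaternions, with bracket `[x, y] = xy - yx`. -/
def su2 : Submodule ℝ ℍ[ℝ] where
  carrier := {q | q.re = 0}
  add_mem' {a b} ha hb := by
    have ha' : a.re = 0 := ha
    have hb' : b.re = 0 := hb
    simp [ha', hb']
  zero_mem' := by simp
  smul_mem' c a ha := by
    have ha' : a.re = 0 := ha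
    simp [ha']

theorem mem_su2 {q : ℍ[ℝ]} : q ∈ su2 ↔ q.re = 0 := Iff.rfl

theorem re_coe_su2 (x : su2) : (x : ℍ[ℝ]).re = 0 := x.2

theorem coe_inv_eq_star (h : SU2) : ((h⁻¹ : SU2) : ℍ[ℝ]) = star (h : ℍ[ℝ]) := by
  have hn : ‖(h : ℍ[ℝ])‖ = 1 := by simp
  have h1 : normSq (h : ℍ[ℝ]) = 1 := by rw [normSq_eq_norm_mul_self, hn]; norm_num
  rw [Metric.unitSphere.coe_inv, Quaternion.inv_def, h1]
  simp

theorem conj_mem_su2 (h : SU2) (x : su2) :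
    (h : ℍ[ℝ]) * (x : ℍ[ℝ]) * ((h⁻¹ : SU2) : ℍ[ℝ]) ∈ su2 := by
  have hx := re_coe_su2 x
  rw [coe_inv_eq_star, mem_su2]
  simp only [Quaternion.re_mul, Quaternion.imI_mul, Quaternion.imJ_mul, Quaternion.imK_mul,
    Quaternion.re_star, Quaternion.imI_star, Quaternion.imJ_star, Quaternion.imK_star, hx]
  ring

/-- The adjoint representation of `SU₂` on `𝔰𝔲₂`. -/
def Ad (h : SU2) (x : su2) : su2 :=
  ⟨(h : ℍ[ℝ]) * (x : ℍ[ℝ]) * ((h⁻¹ : SU2) : ℍ[ℝ]), conj_mem_su2 h x⟩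

theorem Ad_one (x : su2) : Ad 1 x = x := by
  ext1; simp [Ad]

theorem Ad_mul (a b : SU2) (x : su2) : Ad (a * b) x = Ad a (Ad b x) := by
  ext1; simp [Ad, mul_assoc]

theorem continuous_Ad : Continuous fun p : SU2 × su2 => Ad p.1 p.2 := by
  refine Continuous.subtype_mk ?_ _
  exact ((continuous_subtype_val.comp continuous_fst).mul
    (continuous_subtype_val.comp continuous_snd)).mul
    (continuous_subtype_val.comp (continuous_inv.comp continuous_fst))

/-- The exponential map `𝔰𝔲₂ → SU₂`. -/
def expSU2 (x : su2) : SU2 :=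
  ⟨NormedSpace.exp (x : ℍ[ℝ]), by
    rw [mem_sphere_zero_iff_norm, Quaternion.norm_exp, re_coe_su2]
    simp⟩

/-- The exponential map of `G = SU₂ × SU₂`. -/
def expG (X : su2 × su2) : G := (expSU2 X.1, expSU2 X.2)

/-! ### The manifold `M = G ×_H V`

Here `H ⊂ G` is the diagonal subgroup and `V ≅ ℝ³` is its Lie algebra `𝔥 ≅ 𝔰𝔲₂` (identified
through `(X, X) ↔ X`) with the adjoint action. -/

/-- The equivalence relation `(g, v) ∼ (g h, Ad(h⁻¹) v)`, `h ∈ H`, on `G × V`. -/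
def diagSetoid : Setoid (G × su2) where
  r p q := ∃ h : SU2, q = ((p.1.1 * h, p.1.2 * h), Ad h⁻¹ p.2)
  iseqv :=
    { refl := fun p => ⟨1, by simp [Ad_one]⟩
      symm := by
        rintro p q ⟨h, rfl⟩
        exact ⟨h⁻¹, by simp [← Ad_mul, Ad_one]⟩
      trans := by
        rintro p q r ⟨h, rfl⟩ ⟨k, rfl⟩
        exact ⟨h * k, by simp [← Ad_mul, mul_assoc]⟩ }

/-- The associated bundle `M = G ×_H V`. -/
def M : Type := Quotient diagSetoid

/-- The quotient topology. -/
instance : TopologicalSpace M := inferInstanceAs (TopologicalSpace (Quotient diagSetoid))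

/-- The class `[(g, v)] ∈ M`. -/
def mk (g : G) (v : su2) : M := Quotient.mk diagSetoid (g, v)

theorem continuous_mk : Continuous fun p : G × su2 => mk p.1 p.2 :=
  continuous_quotient_mk'

/-- The trivialization `[((g₁, g₂), v)] ↦ (g₁ g₂⁻¹, Ad(g₂) v)` as a map `M → SU₂ × 𝔰𝔲₂`. -/
def trivFun : M → SU2 × su2 :=
  Quotient.lift (fun p : G × su2 => (p.1.1 * p.1.2⁻¹, Ad p.1.2 p.2)) (by
    rintro p q ⟨h, rfl⟩
    simp [← Ad_mul, mul_assoc])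

@[simp] theorem trivFun_mk (g : G) (v : su2) : trivFun (mk g v) = (g.1 * g.2⁻¹, Ad g.2 v) := rfl

theorem continuous_trivFun : Continuous trivFun := by
  refine Continuous.quotient_lift (s := diagSetoid) ?_ _
  have h1 : Continuous fun p : G × su2 => p.1.1 := continuous_fst.comp continuous_fst
  have h2 : Continuous fun p : G × su2 => p.1.2 := continuous_snd.comp continuous_fst
  have h3 : Continuous fun p : G × su2 => Ad p.1.2 p.2 :=
    Continuous.comp (g := fun p : SU2 × su2 => Ad p.1 p.2)
      (f := fun p : G × su2 => (p.1.2, p.2)) continuous_Ad (h2.prodMk continuous_snd)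
  exact (h1.mul h2.inv).prodMk h3

theorem continuous_trivInv : Continuous fun q : SU2 × su2 => mk (q.1, 1) q.2 :=
  Continuous.comp (g := fun p : G × su2 => mk p.1 p.2)
    (f := fun q : SU2 × su2 => (((q.1, (1 : SU2)) : G), q.2)) continuous_mk
    ((continuous_fst.prodMk continuous_const).prodMk continuous_snd)

theorem mk_trivFun (p : M) : mk ((trivFun p).1, 1) (trivFun p).2 = p := by
  induction p using Quotient.inductionOn with
  | _ p =>
    obtain ⟨g, v⟩ := p
    change mk (g.1 * g.2⁻¹, 1) (Ad g.2 v) = mk g v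
    refine Quotient.sound (s := diagSetoid) ⟨g.2, ?_⟩
    simp only [← Ad_mul, inv_mul_cancel, Ad_one, inv_mul_cancel_right, one_mul]

theorem trivFun_mk_one (q : SU2 × su2) : trivFun (mk (q.1, 1) q.2) = q := by
  simp only [trivFun_mk, inv_one, mul_one, Ad_one]

/-- The trivialization is a homeomorphism `M ≃ S³ × ℝ³` for the quotient topology. -/
def triv : M ≃ₜ SU2 × su2 where
  toFun := trivFun
  invFun q := mk (q.1, 1) q.2
  left_inv := mk_trivFun
  right_inv := trivFun_mk_one
  continuous_toFun := continuous_trivFun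
  continuous_invFun := continuous_trivInv

/-- The model vector space of `M`. -/
abbrev E : Type := EuclideanSpace ℝ (Fin 3) × su2

/-- The model with corners (without boundary) of `M`. -/
abbrev I : ModelWithCorners ℝ E (ModelProd (EuclideanSpace ℝ (Fin 3)) su2) :=
  (𝓡 3).prod 𝓘(ℝ, su2)

/-- The smooth structure of `M`: the one for which `triv : M → S³ × ℝ³` is a diffeomorphism. As
`G × V → S³ × ℝ³`, `((g₁, g₂), v) ↦ (g₁ g₂⁻¹, Ad(g₂) v)`, is a submersion, this is the unique
smooth structure for which the projection `G × V → M` is a submersion. -/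
instance : ChartedSpace (ModelProd (EuclideanSpace ℝ (Fin 3)) su2) M where
  atlas := {c | ∃ c' ∈ atlas (ModelProd (EuclideanSpace ℝ (Fin 3)) su2) (SU2 × su2),
    c = triv.toOpenPartialHomeomorph.trans c'}
  chartAt p := triv.toOpenPartialHomeomorph.trans
    (chartAt (ModelProd (EuclideanSpace ℝ (Fin 3)) su2) (triv p))
  mem_chart_source p := by simp
  chart_mem_atlas p := ⟨_, chart_mem_atlas _ _, rfl⟩

theorem chartAt_eq (p : M) :
    chartAt (ModelProd (EuclideanSpace ℝ (Fin 3)) su2) p = triv.toOpenPartialHomeomorph.trans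
      (chartAt (ModelProd (EuclideanSpace ℝ (Fin 3)) su2) (triv p)) := rfl

instance : IsManifold I ∞ M where
  compatible := by
    rintro _ _ ⟨c, hc, rfl⟩ ⟨d, hd, rfl⟩
    have h := (contDiffGroupoid ∞ I).compatible hc hd
    refine (contDiffGroupoid ∞ I).mem_of_eqOnSource h ⟨?_, ?_⟩
    · ext z
      simp
    · intro z _
      simp

theorem contMDiff_triv : ContMDiff I I ∞ triv := by
  intro p
  set c := chartAt (ModelProd (EuclideanSpace ℝ (Fin 3)) su2) (triv p) with hc
  have h1 : ContMDiffAt I I ∞ (chartAt (ModelProd (EuclideanSpace ℝ (Fin 3)) su2) p) p :=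
    contMDiffAt_of_mem_maximalAtlas (IsManifold.chart_mem_maximalAtlas p) (mem_chart_source _ p)
  have h2 : ContMDiffAt I I ∞ c.symm (c (triv p)) :=
    contMDiffAt_symm_of_mem_maximalAtlas (IsManifold.chart_mem_maximalAtlas (triv p))
      (c.map_source (mem_chart_source _ (triv p)))
  have h3 := ContMDiffAt.comp (g := c.symm) (I' := I) p (by exact h2) h1
  refine h3.congr_of_eventuallyEq ?_
  have : c.source ∈ nhds (triv p) := c.open_source.mem_nhds (mem_chart_source _ _)
  filter_upwards [triv.continuous.continuousAt this] with z hz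
  simp only [Function.comp, chartAt_eq p, ← hc, OpenPartialHomeomorph.coe_trans]
  exact (c.left_inv hz).symm

theorem contMDiff_triv_symm : ContMDiff I I ∞ triv.symm := by
  intro q
  set c := chartAt (ModelProd (EuclideanSpace ℝ (Fin 3)) su2) q with hc
  set d := chartAt (ModelProd (EuclideanSpace ℝ (Fin 3)) su2) (triv.symm q) with hd
  have hd' : d = triv.toOpenPartialHomeomorph.trans c := by
    rw [hd, chartAt_eq, triv.apply_symm_apply]
  have h1 : ContMDiffAt I I ∞ c q :=
    contMDiffAt_of_mem_maximalAtlas (IsManifold.chart_mem_maximalAtlas q) (mem_chart_source _ q)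
  have h2 : ContMDiffAt I I ∞ d.symm (c q) := by
    have := contMDiffAt_symm_of_mem_maximalAtlas (n := ∞) (I := I)
      (IsManifold.chart_mem_maximalAtlas (triv.symm q))
      (d.map_source (mem_chart_source _ (triv.symm q)))
    have e : d (triv.symm q) = c q := by simp [hd']
    rwa [e] at this
  have h3 := ContMDiffAt.comp (g := d.symm) (I' := I) q h2 h1
  refine h3.congr_of_eventuallyEq ?_
  have : c.source ∈ nhds q := c.open_source.mem_nhds (mem_chart_source _ _)
  filter_upwards [this] with z hz
  simp [hd', c.left_inv hz]

/-! ### The action of `G`, the curve `γ`, and the frame along it -/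

/-- The natural action `a · [(g, v)] = [(a g, v)]` of `G` on `M = G ×_H V`. -/
instance : MulAction G M where
  smul a := Quotient.map (sa := diagSetoid) (sb := diagSetoid)
    (fun p : G × su2 => ((a * p.1, p.2) : G × su2)) (by
      rintro p q ⟨h, rfl⟩
      exact ⟨h, by simp [Prod.ext_iff, mul_assoc]⟩)
  one_smul p := by
    induction p using Quotient.inductionOn with
    | _ p =>
      change mk (1 * p.1) p.2 = mk p.1 p.2
      rw [one_mul]
  mul_smul a b p := by
    induction p using Quotient.inductionOn with
    | _ p =>
      change mk (a * b * p.1) p.2 = mk (a * (b * p.1)) p.2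
      rw [mul_assoc]

theorem smul_mk (a g : G) (v : su2) : a • mk g v = mk (a * g) v := rfl

/-- The Lie bracket of `𝔰𝔲₂`. -/
def bracket (x y : su2) : su2 :=
  ⟨(x : ℍ[ℝ]) * y - (y : ℍ[ℝ]) * x, by
    rw [mem_su2]
    simp only [Quaternion.re_sub, Quaternion.re_mul]
    ring⟩

/-- The generator `H = i/2 = diag(i/2, -i/2)` of a Cartan subalgebra of `𝔰𝔲₂`. -/
def vecH : su2 := ⟨⟨0, 1 / 2, 0, 0⟩, rfl⟩

/-- The element `E = j/(2√2)` of `H^⊥`, of square length `-1` for the Killing form of `𝔰𝔲₂`. -/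
def vecE : su2 := ⟨⟨0, 0, 1 / (2 * √2), 0⟩, rfl⟩

/-- `V = [H, E]`. -/
def vecV : su2 := bracket vecH vecE

/-- `A = (H, -H)`. -/
def vecA : su2 × su2 := (vecH, -vecH)

/-- `E₁ = (E, 0)`. -/
def vecE₁ : su2 × su2 := (vecE, 0)

/-- `V₁ = (V, 0)`. -/
def vecV₁ : su2 × su2 := (vecV, 0)

/-- `E₂ = (0, E)`. -/
def vecE₂ : su2 × su2 := (0, vecE)

/-- `V₂ = (0, V)`. -/
def vecV₂ : su2 × su2 := (0, vecV)

/-- The curve `γ_t = [(e, t U)]`, where `U = (H, H) ∈ 𝔥` is identified with `H ∈ 𝔰𝔲₂`. -/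
def γ (t : ℝ) : M := mk 1 (t • vecH)

/-- The singular orbit `S = G · γ₀ = {[(g, 0)]} ≅ S³`. -/
def S : Set M := MulAction.orbit G (γ 0)

/-- The velocity `ξ = γ'(t)`. -/
def velocity (t : ℝ) : TangentSpace I (γ t) := mfderiv 𝓘(ℝ, ℝ) I γ t (1 : ℝ)

/-- The value at `p` of the fundamental vector field `X̂`, i.e. the velocity at `s = 0` of the curve
`s ↦ exp(s X) · p`, which passes through `p` at `s = 0`. -/
def fundamental (X : su2 × su2) (p : M) : TangentSpace I p :=
  (mfderiv 𝓘(ℝ, ℝ) I (fun s : ℝ => expG (s • X) • p) 0 (1 : ℝ) : E)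

/-- The vectors `(ξ, Â, Ê₁, V̂₁, Ê₂, V̂₂)` at `γ_t`. -/
def frame (t : ℝ) : Fin 6 → TangentSpace I (γ t) :=
  ![velocity t, fundamental vecA (γ t), fundamental vecE₁ (γ t), fundamental vecV₁ (γ t),
    fundamental vecE₂ (γ t), fundamental vecV₂ (γ t)]

/-! The frame is a basis for `t ≠ 0`. -/

/-- The projection `ℍ → Im ℍ = 𝔰𝔲₂`. -/
def imProj : ℍ[ℝ] →L[ℝ] su2 :=
  LinearMap.toContinuousLinearMap
    { toFun := fun q => ⟨q.im, by simp [mem_su2]⟩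
      map_add' := fun a b => by ext1; simp
      map_smul' := fun c a => by ext1; simp }

theorem imProj_coe (x : su2) : imProj (x : ℍ[ℝ]) = x := by
  ext1
  have := re_coe_su2 x
  ext <;> simp [imProj, this]

/-- The map `M → ℍ × 𝔰𝔲₂` induced by the trivialization and the inclusion `SU₂ ⊂ ℍ`. -/
def emb (p : M) : ℍ[ℝ] × su2 := (((triv p).1 : ℍ[ℝ]), (triv p).2)

theorem contMDiff_emb : ContMDiff I 𝓘(ℝ, ℍ[ℝ] × su2) ∞ emb := by
  have h1 : ContMDiff I (𝓡 3) ∞ fun p : M => (triv p).1 := contMDiff_fst.comp contMDiff_triv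
  have h2 : ContMDiff I 𝓘(ℝ, su2) ∞ fun p : M => (triv p).2 := contMDiff_snd.comp contMDiff_triv
  exact (contMDiff_coe_sphere.comp h1).prodMk_space h2

theorem contMDiff_curve {c : ℝ → M} (h : ContDiff ℝ ∞ (emb ∘ c)) :
    ContMDiff 𝓘(ℝ, ℝ) I ∞ c := by
  have h1 : ContMDiff 𝓘(ℝ, ℝ) 𝓘(ℝ, ℍ[ℝ]) ∞ fun s => ((triv (c s)).1 : ℍ[ℝ]) :=
    (contDiff_fst.comp h).contMDiff
  have h2 : ContMDiff 𝓘(ℝ, ℝ) 𝓘(ℝ, su2) ∞ fun s => (triv (c s)).2 :=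
    (contDiff_snd.comp h).contMDiff
  have h3 : ContMDiff 𝓘(ℝ, ℝ) (𝓡 3) ∞ fun s => (triv (c s)).1 :=
    h1.codRestrict_sphere fun s => (triv (c s)).1.2
  have h4 : ContMDiff 𝓘(ℝ, ℝ) I ∞ fun s => triv (c s) := h3.prodMk h2
  have h5 := contMDiff_triv_symm.comp h4
  have h6 : triv.symm ∘ (fun s => triv (c s)) = c := by
    funext s
    simp
  rwa [h6] at h5

theorem mfderiv_emb_curve {c : ℝ → M} (h : ContDiff ℝ ∞ (emb ∘ c)) {s : ℝ} {w : ℍ[ℝ] × su2}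
    (hw : HasDerivAt (emb ∘ c) w s) :
    mfderiv I 𝓘(ℝ, ℍ[ℝ] × su2) emb (c s) (mfderiv 𝓘(ℝ, ℝ) I c s (1 : ℝ)) = w := by
  have hc : MDifferentiableAt 𝓘(ℝ, ℝ) I c s :=
    ((contMDiff_curve h) s).mdifferentiableAt (by simp)
  have he : MDifferentiableAt I 𝓘(ℝ, ℍ[ℝ] × su2) emb (c s) :=
    (contMDiff_emb (c s)).mdifferentiableAt (by simp)
  have h1 := mfderiv_comp_apply s he hc (1 : ℝ)
  rw [← h1, mfderiv_eq_fderiv]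
  rw [hw.hasFDerivAt.fderiv]
  exact one_smul ℝ w

theorem emb_γ (t : ℝ) : emb (γ t) = ((1 : ℍ[ℝ]), t • vecH) := by
  change (((1 * 1⁻¹ : SU2) : ℍ[ℝ]), Ad 1 (t • vecH)) = _
  rw [Ad_one]
  simp

theorem coe_expSU2_inv (x : su2) : ((expSU2 x)⁻¹ : SU2) = expSU2 (-x) := by
  apply Subtype.ext
  rw [coe_inv_eq_star]
  have hx : star (x : ℍ[ℝ]) = -(x : ℍ[ℝ]) := by
    have := re_coe_su2 x
    ext <;> simp [this]
  change star (NormedSpace.exp (x : ℍ[ℝ])) = NormedSpace.exp ((-x : su2) : ℍ[ℝ])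
  rw [NormedSpace.star_exp, hx]
  rfl

theorem emb_fundamental_curve (X : su2 × su2) (t s : ℝ) :
    emb (expG (s • X) • γ t) =
      (NormedSpace.exp (s • (X.1 : ℍ[ℝ])) * NormedSpace.exp (s • -(X.2 : ℍ[ℝ])),
        imProj (NormedSpace.exp (s • (X.2 : ℍ[ℝ])) * (t • (vecH : ℍ[ℝ])) *
          NormedSpace.exp (s • -(X.2 : ℍ[ℝ])))) := by
  have h1 : ((expSU2 (s • X.2))⁻¹ : SU2) = expSU2 (s • -X.2) := by
    rw [coe_expSU2_inv, smul_neg]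
  have h2 : emb (expG (s • X) • γ t) =
      (((expSU2 (s • X.1) * 1 * (expSU2 (s • X.2) * 1)⁻¹ : SU2) : ℍ[ℝ]),
        Ad (expSU2 (s • X.2) * 1) (t • vecH)) := rfl
  rw [h2, mul_one, mul_one, h1, ← imProj_coe (Ad _ _)]
  simp only [Ad, h1]
  rfl

theorem hasDerivAt_exp_smul_zero (x : ℍ[ℝ]) :
    HasDerivAt (fun s : ℝ => NormedSpace.exp (s • x)) x 0 := by
  have h := hasDerivAt_exp_smul_const (𝕂 := ℝ) x (0 : ℝ)
  simpa using h

theorem contDiff_exp_smul (x : ℍ[ℝ]) : ContDiff ℝ ∞ fun s : ℝ => NormedSpace.exp (s • x) := by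
  have h : ContDiff ℝ ∞ (NormedSpace.exp : ℍ[ℝ] → ℍ[ℝ]) := by
    rw [contDiff_iff_contDiffAt]
    exact fun y => (NormedSpace.exp_analytic (𝕂 := ℝ) y).contDiffAt
  exact h.comp (contDiff_id.smul contDiff_const)

theorem emb_velocity (t : ℝ) :
    mfderiv I 𝓘(ℝ, ℍ[ℝ] × su2) emb (γ t) (velocity t) = ((0 : ℍ[ℝ]), vecH) := by
  have h : emb ∘ γ = fun t : ℝ => ((1 : ℍ[ℝ]), t • vecH) := funext emb_γ
  refine mfderiv_emb_curve ?_ ?_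
  · rw [h]
    exact contDiff_const.prodMk (contDiff_id.smul contDiff_const)
  · rw [h]
    have h2 : HasDerivAt (fun s : ℝ => s • vecH) ((1 : ℝ) • vecH) t :=
      (hasDerivAt_id t).smul_const vecH
    rw [one_smul] at h2
    exact (hasDerivAt_const t (1 : ℍ[ℝ])).prodMk h2

theorem emb_fundamental (X : su2 × su2) (t : ℝ) :
    mfderiv I 𝓘(ℝ, ℍ[ℝ] × su2) emb (γ t) (fundamental X (γ t)) =
      ((X.1 : ℍ[ℝ]) - X.2, t • bracket X.2 vecH) := by
  set c : ℝ → M := fun s => expG (s • X) • γ t with hc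
  have h0 : c 0 = γ t := by
    have h1 : expG ((0 : ℝ) • X) = 1 := by
      ext1 <;> apply Subtype.ext <;> simp [expG, expSU2]
    simp only [hc, h1, one_smul]
  have h : emb ∘ c = fun s : ℝ =>
      (NormedSpace.exp (s • (X.1 : ℍ[ℝ])) * NormedSpace.exp (s • -(X.2 : ℍ[ℝ])),
        imProj (NormedSpace.exp (s • (X.2 : ℍ[ℝ])) * (t • (vecH : ℍ[ℝ])) *
          NormedSpace.exp (s • -(X.2 : ℍ[ℝ])))) := funext (emb_fundamental_curve X t)
  have hs : ContDiff ℝ ∞ (emb ∘ c) := by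
    rw [h]
    exact ((contDiff_exp_smul _).mul (contDiff_exp_smul _)).prodMk
      (imProj.contDiff.comp (((contDiff_exp_smul _).mul contDiff_const).mul (contDiff_exp_smul _)))
  have hd : HasDerivAt (emb ∘ c) ((X.1 : ℍ[ℝ]) - X.2, t • bracket X.2 vecH) 0 := by
    rw [h]
    have a1 := (hasDerivAt_exp_smul_zero (X.1 : ℍ[ℝ])).mul
      (hasDerivAt_exp_smul_zero (-(X.2 : ℍ[ℝ])))
    have a2 := ((hasDerivAt_exp_smul_zero (X.2 : ℍ[ℝ])).mul_const (t • (vecH : ℍ[ℝ]))).mul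
      (hasDerivAt_exp_smul_zero (-(X.2 : ℍ[ℝ])))
    have a3 := imProj.hasFDerivAt.comp_hasDerivAt (0 : ℝ) a2
    convert! a1.prodMk a3 using 2
    · simp [sub_eq_add_neg]
    · rw [← imProj_coe (t • bracket X.2 vecH)]
      congr 1
      simp [bracket, sub_eq_add_neg]
  have key := mfderiv_emb_curve hs hd
  rw [h0] at key
  exact key

theorem vecH_coords : (vecH : ℍ[ℝ]).imI = 1 / 2 ∧ (vecH : ℍ[ℝ]).imJ = 0 ∧
    (vecH : ℍ[ℝ]).imK = 0 := ⟨rfl, rfl, rfl⟩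

theorem vecE_coords : (vecE : ℍ[ℝ]).imI = 0 ∧ (vecE : ℍ[ℝ]).imJ = 1 / (2 * √2) ∧
    (vecE : ℍ[ℝ]).imK = 0 := ⟨rfl, rfl, rfl⟩

theorem bracket_coords (x y : su2) :
    (bracket x y : ℍ[ℝ]).imI = 2 * ((x : ℍ[ℝ]).imJ * (y : ℍ[ℝ]).imK -
      (x : ℍ[ℝ]).imK * (y : ℍ[ℝ]).imJ) ∧
    (bracket x y : ℍ[ℝ]).imJ = 2 * ((x : ℍ[ℝ]).imK * (y : ℍ[ℝ]).imI -
      (x : ℍ[ℝ]).imI * (y : ℍ[ℝ]).imK) ∧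
    (bracket x y : ℍ[ℝ]).imK = 2 * ((x : ℍ[ℝ]).imI * (y : ℍ[ℝ]).imJ -
      (x : ℍ[ℝ]).imJ * (y : ℍ[ℝ]).imI) := by
  simp only [bracket, Quaternion.imI_sub, Quaternion.imJ_sub, Quaternion.imK_sub,
    Quaternion.imI_mul, Quaternion.imJ_mul, Quaternion.imK_mul]
  refine ⟨?_, ?_, ?_⟩ <;> ring

theorem vecV_coords : (vecV : ℍ[ℝ]).imI = 0 ∧ (vecV : ℍ[ℝ]).imJ = 0 ∧
    (vecV : ℍ[ℝ]).imK = 1 / (2 * √2) := by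
  obtain ⟨h1, h2, h3⟩ := bracket_coords vecH vecE
  obtain ⟨a1, a2, a3⟩ := vecH_coords
  obtain ⟨b1, b2, b3⟩ := vecE_coords
  simp only [a1, a2, a3, b1, b2, b3] at h1 h2 h3
  refine ⟨?_, ?_, ?_⟩
  · rw [vecV, h1]; ring
  · rw [vecV, h2]; ring
  · rw [vecV, h3]; ring

theorem finrank_su2 : Module.finrank ℝ su2 = 3 := by
  let e : su2 ≃ₗ[ℝ] (Fin 3 → ℝ) :=
    { toFun := fun x => ![(x : ℍ[ℝ]).imI, (x : ℍ[ℝ]).imJ, (x : ℍ[ℝ]).imK]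
      invFun := fun y => ⟨⟨0, y 0, y 1, y 2⟩, rfl⟩
      map_add' := fun a b => by
        ext i
        fin_cases i <;> simp
      map_smul' := fun a b => by
        ext i
        fin_cases i <;> simp
      left_inv := fun x => by
        have := re_coe_su2 x
        ext1
        ext <;> simp [this]
      right_inv := fun y => by
        ext i
        fin_cases i <;> rfl }
  simpa using e.finrank_eq

theorem linearIndependent_frame {t : ℝ} (ht : t ≠ 0) : LinearIndependent ℝ (frame t) := by
  rw [Fintype.linearIndependent_iff]
  intro g hg
  have h := congrArg (mfderiv I 𝓘(ℝ, ℍ[ℝ] × su2) emb (γ t)) hg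
  simp only [Fin.sum_univ_six, map_add, map_smul, map_zero] at h
  have e0 : mfderiv I 𝓘(ℝ, ℍ[ℝ] × su2) emb (γ t) (frame t 0) = _ := emb_velocity t
  have e1 : mfderiv I 𝓘(ℝ, ℍ[ℝ] × su2) emb (γ t) (frame t 1) = _ := emb_fundamental vecA t
  have e2 : mfderiv I 𝓘(ℝ, ℍ[ℝ] × su2) emb (γ t) (frame t 2) = _ := emb_fundamental vecE₁ t
  have e3 : mfderiv I 𝓘(ℝ, ℍ[ℝ] × su2) emb (γ t) (frame t 3) = _ := emb_fundamental vecV₁ t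
  have e4 : mfderiv I 𝓘(ℝ, ℍ[ℝ] × su2) emb (γ t) (frame t 4) = _ := emb_fundamental vecE₂ t
  have e5 : mfderiv I 𝓘(ℝ, ℍ[ℝ] × su2) emb (γ t) (frame t 5) = _ := emb_fundamental vecV₂ t
  rw [e0, e1, e2, e3, e4, e5] at h
  have hp : 1 / (2 * √2) ≠ (0 : ℝ) := by positivity
  obtain ⟨a1, a2, a3⟩ := vecH_coords
  obtain ⟨b1, b2, b3⟩ := vecE_coords
  obtain ⟨c1, c2, c3⟩ := vecV_coords
  generalize 1 / (2 * √2) = k at hp b2 c3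
  have q1 : g 0 • (0 : ℍ[ℝ]) + g 1 • ((vecH : ℍ[ℝ]) - ((-vecH : su2) : ℍ[ℝ]))
      + g 2 • ((vecE : ℍ[ℝ]) - ((0 : su2) : ℍ[ℝ])) + g 3 • ((vecV : ℍ[ℝ]) - ((0 : su2) : ℍ[ℝ]))
      + g 4 • (((0 : su2) : ℍ[ℝ]) - (vecE : ℍ[ℝ])) + g 5 • (((0 : su2) : ℍ[ℝ]) - (vecV : ℍ[ℝ]))
      = 0 := congrArg Prod.fst h
  have q2 : g 0 • vecH + g 1 • t • bracket (-vecH) vecH + g 2 • t • bracket 0 vecH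
      + g 3 • t • bracket 0 vecH + g 4 • t • bracket vecE vecH + g 5 • t • bracket vecV vecH
      = 0 := congrArg Prod.snd h
  have q3 := congrArg (fun x : su2 => (x : ℍ[ℝ])) q2
  have i1 := congrArg (fun x : ℍ[ℝ] => x.imI) q1
  have j1 := congrArg (fun x : ℍ[ℝ] => x.imJ) q1
  have k1 := congrArg (fun x : ℍ[ℝ] => x.imK) q1
  have i2 := congrArg (fun x : ℍ[ℝ] => x.imI) q3
  have j2 := congrArg (fun x : ℍ[ℝ] => x.imJ) q3
  have k2 := congrArg (fun x : ℍ[ℝ] => x.imK) q3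
  simp [bracket_coords, a1, a2, a3, b1, b2, b3, c1, c2, c3] at i1 j1 k1 i2 j2 k2
  have z4 : g 4 = 0 := by tauto
  have z5 : g 5 = 0 := by tauto
  rw [z4] at j1
  rw [z5] at k1
  have z2 : g 2 = 0 := by simpa [hp] using j1
  have z3 : g 3 = 0 := by simpa [hp] using k1
  have z1 : g 1 = 0 := by linarith
  intro i
  fin_cases i
  exacts [i2, z1, z2, z3, z4, z5]

/-- The basis `B_t = (ξ, Â, Ê₁, V̂₁, Ê₂, V̂₂)` of `T_{γ_t} M`, `t ≠ 0`. -/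
def frameBasis (t : ℝ) (ht : t ≠ 0) : Module.Basis (Fin 6) ℝ (TangentSpace I (γ t)) :=
  basisOfLinearIndependentOfCardEqFinrank (linearIndependent_frame ht) (by
    change Fintype.card (Fin 6) = Module.finrank ℝ E
    rw [Module.finrank_prod, finrank_su2]
    simp)

theorem coe_frameBasis (t : ℝ) (ht : t ≠ 0) : ⇑(frameBasis t ht) = frame t :=
  coe_basisOfLinearIndependentOfCardEqFinrank _ _

/-! ### The invariant forms `ω¹, …, ω⁵` along `γ` -/

/-- The dual coframe `(ξ*, A*, E₁*, V₁*, E₂*, V₂*)` at `γ_t`, `t ≠ 0`. -/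
def coframe (t : ℝ) (ht : t ≠ 0) (j : Fin 6) : Module.Dual ℝ (TangentSpace I (γ t)) :=
  (frameBasis t ht).coord j

/-- The wedge product `α ∧ β` of two covectors. -/
def wedge {T : Type*} [AddCommGroup T] [Module ℝ T] (α β : Module.Dual ℝ T) (v w : T) : ℝ :=
  α v * β w - α w * β v

/-- `ω¹ = ξ* ∧ A*`. -/
def form₁ (t : ℝ) (ht : t ≠ 0) (v w : TangentSpace I (γ t)) : ℝ :=
  wedge (coframe t ht 0) (coframe t ht 1) v w

/-- `ω² = E₁* ∧ V₁*`. -/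
def form₂ (t : ℝ) (ht : t ≠ 0) (v w : TangentSpace I (γ t)) : ℝ :=
  wedge (coframe t ht 2) (coframe t ht 3) v w

/-- `ω³ = E₂* ∧ V₂*`. -/
def form₃ (t : ℝ) (ht : t ≠ 0) (v w : TangentSpace I (γ t)) : ℝ :=
  wedge (coframe t ht 4) (coframe t ht 5) v w

/-- `ω⁴ = E₁* ∧ E₂* + V₁* ∧ V₂*`. -/
def form₄ (t : ℝ) (ht : t ≠ 0) (v w : TangentSpace I (γ t)) : ℝ :=
  wedge (coframe t ht 2) (coframe t ht 4) v w + wedge (coframe t ht 3) (coframe t ht 5) v w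

/-- `ω⁵ = E₁* ∧ V₂* - V₁* ∧ E₂*`. -/
def form₅ (t : ℝ) (ht : t ≠ 0) (v w : TangentSpace I (γ t)) : ℝ :=
  wedge (coframe t ht 2) (coframe t ht 5) v w - wedge (coframe t ht 3) (coframe t ht 4) v w

/-! ### Differential 2-forms on `M` -/

/-- A field of bilinear forms on the tangent spaces of `M`. -/
abbrev BilinField : Type := ∀ p : M, TangentSpace I p →L[ℝ] TangentSpace I p →L[ℝ] ℝ

/-- `Ω` is a smooth differential 2-form on `U ⊆ M` (its values off `U` are irrelevant): it is
alternating and a smooth section of the bundle of bilinear forms on `TM` over `U`. -/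
structure IsTwoFormOn (Ω : BilinField) (U : Set M) : Prop where
  alternating : ∀ p ∈ U, ∀ v : TangentSpace I p, Ω p v v = 0
  smooth : ContMDiffOn I (I.prod 𝓘(ℝ, E →L[ℝ] E →L[ℝ] ℝ)) ∞
    (fun p : M => Bundle.TotalSpace.mk' (E →L[ℝ] E →L[ℝ] ℝ) p (Ω p)) U

/-- `Ω` is `G`-invariant on the invariant set `U`: `a^* Ω = Ω` on `U` for every `a ∈ G`. -/
def IsInvariantOn (Ω : BilinField) (U : Set M) : Prop :=
  ∀ a : G, ∀ p ∈ U, ∀ v w : TangentSpace I p,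
    Ω (a • p) (mfderiv I I (fun q : M => a • q) p v) (mfderiv I I (fun q : M => a • q) p w) =
      Ω p v w

/-- The bilinear form `Ω` on `T` is nondegenerate. -/
def IsNondegenerate {T : Type*} [AddCommGroup T] [Module ℝ T] [TopologicalSpace T]
    (Ω : T →L[ℝ] T →L[ℝ] ℝ) : Prop :=
  ∀ v : T, (∀ w : T, Ω v w = 0) → v = 0

/-- The exterior cube `Ω³ = Ω ∧ Ω ∧ Ω` of an alternating bilinear form, evaluated on six
vectors. -/
def cube {T : Type*} [AddCommGroup T] [Module ℝ T] [TopologicalSpace T]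
    (Ω : T →L[ℝ] T →L[ℝ] ℝ) (v : Fin 6 → T) : ℝ :=
  (1 / 8) * ∑ σ : Equiv.Perm (Fin 6), ((Equiv.Perm.sign σ : ℤ) : ℝ) *
    (Ω (v (σ 0)) (v (σ 1)) * Ω (v (σ 2)) (v (σ 3)) * Ω (v (σ 4)) (v (σ 5)))

/-- `F : ℝ → ℝ` is a smooth extension to `t = 0` of the function `f` on `ℝ ∖ {0}`
(the value `f 0` is irrelevant). -/
def SmoothlyExtends (f F : ℝ → ℝ) : Prop :=
  ContDiff ℝ ∞ F ∧ ∀ t : ℝ, t ≠ 0 → F t = f t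

end CohomOne

end

noncomputable section

/-! ### Smooth even and odd functions of one variable -/

/-! `triv` identifies `M` with `S³ × 𝔰𝔲₂`, and the left Maurer-Cartan form of `S³` together with the
differential of the fibre coordinate trivializes `TM` with fibre `𝔰𝔲₂ ⊕ 𝔰𝔲₂` (`theta`). In this
trivialization `a = (a₁, a₂)` acts on tangent vectors by `Ad a₂ ⊕ Ad a₂` (`theta_smul`). An
invariant form is therefore an `SU₂`-equivariant map from `𝔰𝔲₂ ∖ {0}` to alternating forms on `𝔰𝔲₂ ⊕
𝔰𝔲₂`, and the question is when this map is smooth at `0`.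

For sufficiency, five equivariant forms built from inner and triple products, with coefficients that
are functions of `‖v‖`, make up `modelForm`. Along `γ` they give (`modelForm_vecH`) `f₁ = t²Q - 4P`,
`f₂ = tA`, `f₃ = t³C + tA - 2tP`, `f₄ = t²R`, `f₅ = tP - tA`. The conditions on parity, values and
first derivatives are what makes this system solvable for smooth even `A, C, P, Q, R` by repeated
Hadamard division, and smooth even functions of the norm are smooth (`contDiff_comp_norm`); see
`CoeffConditions.exists_model`.

For necessity, the matrix of an extension is smooth along `γ`. The element of `SU₂` that reverses
`vecH` gives the parities, and equivariance at the fixed point `v = 0` ties the values of the mixed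
entries to each other, which yields the derivative relations (`exists_coeffConditions`).

At `v = 0` the model form is `-2 F₁(0)` times the standard symplectic form on `𝔰𝔲₂ ⊕ 𝔰𝔲₂`, whence
both nondegeneracy statements. -/

theorem hasDerivAt_integral_pow_mul (k : ℕ) {H : ℝ → ℝ} (hH : ContDiff ℝ 1 H) (t : ℝ) :
    HasDerivAt (fun t => ∫ s in (0 : ℝ)..1, s ^ k * H (s * t))
      (∫ s in (0 : ℝ)..1, s ^ (k + 1) * deriv H (s * t)) t := by
  have hc : Continuous H := hH.continuous
  have hd : Continuous (deriv H) := hH.continuous_deriv le_rfl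
  -- For `s ∈ [0, 1]` and `|x - t| < 1` the argument `s * x` stays in this ball, so a constant
  -- dominates the derivative.
  obtain ⟨C, hC⟩ := (isCompact_closedBall (0 : ℝ) (|t| + 1)).exists_bound_of_continuousOn
    hd.continuousOn
  refine (intervalIntegral.hasDerivAt_integral_of_dominated_loc_of_deriv_le
    (F := fun t s => s ^ k * H (s * t)) (F' := fun t s => s ^ (k + 1) * deriv H (s * t))
    (bound := fun _ => C) (Metric.ball_mem_nhds t one_pos) ?_ ?_ ?_ ?_ ?_ ?_).2
  · exact Filter.Eventually.of_forall fun x => Continuous.aestronglyMeasurable (by fun_prop)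
  · exact Continuous.intervalIntegrable (by fun_prop) _ _
  · exact Continuous.aestronglyMeasurable (by fun_prop)
  · refine Filter.Eventually.of_forall fun s hs x hx => ?_
    rw [Set.uIoc_of_le zero_le_one] at hs
    have hx' : |x| ≤ |t| + 1 := by
      have h1 : |x - t| < 1 := by simpa [Real.dist_eq] using hx
      have h2 := abs_add_le (x - t) t
      rw [sub_add_cancel] at h2
      linarith
    have h3 : ‖deriv H (s * x)‖ ≤ C := by
      refine hC _ ?_
      rw [mem_closedBall_zero_iff, norm_mul, Real.norm_of_nonneg hs.1.le, Real.norm_eq_abs]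
      nlinarith [abs_nonneg x, hs.1, hs.2]
    rw [norm_mul, norm_pow, Real.norm_of_nonneg hs.1.le]
    calc s ^ (k + 1) * ‖deriv H (s * x)‖ ≤ 1 * ‖deriv H (s * x)‖ :=
          mul_le_mul_of_nonneg_right (pow_le_one₀ hs.1.le hs.2) (norm_nonneg _)
      _ ≤ C := by rwa [one_mul]
  · exact continuous_const.intervalIntegrable _ _
  · refine Filter.Eventually.of_forall fun s _ x _ => ?_
    have h1 : HasDerivAt H (deriv H (s * x)) (s * x) :=
      (hH.differentiable one_ne_zero).differentiableAt.hasDerivAt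
    have h2 : HasDerivAt (fun x : ℝ => s * x) s x := by
      simpa using (hasDerivAt_id x).const_mul s
    have h3 := (h1.comp x h2).const_mul (s ^ k)
    convert! h3 using 1
    ring

/-- Each derivative in `t` brings out one more factor `s`; with the weight `s ^ k` the family is
closed under differentiation, so induction on the order works for all `k` and `H` at once. -/
theorem contDiff_integral_pow_mul {H : ℝ → ℝ} (hH : ContDiff ℝ ∞ H) (k : ℕ) :
    ContDiff ℝ ∞ fun t => ∫ s in (0 : ℝ)..1, s ^ k * H (s * t) := by
  rw [contDiff_infty]
  intro n
  induction n generalizing k H with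
  | zero =>
    refine contDiff_zero.2 (continuous_iff_continuousAt.2 fun t => ?_)
    exact (hasDerivAt_integral_pow_mul k (hH.of_le (by simp)) t).continuousAt
  | succ n ih =>
    have h := hasDerivAt_integral_pow_mul k (hH.of_le (by simp) : ContDiff ℝ 1 H)
    rw [Nat.cast_add, Nat.cast_one, contDiff_succ_iff_deriv]
    refine ⟨fun t => (h t).differentiableAt, by simp, ?_⟩
    rw [funext fun t => (h t).deriv]
    exact ih (contDiff_infty_iff_deriv.1 hH).2 (k + 1)

/-- Hadamard's lemma on the line, with parities. -/
theorem exists_contDiff_eq_mul {F : ℝ → ℝ} (hF : ContDiff ℝ ∞ F) (h0 : F 0 = 0) :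
    ∃ G : ℝ → ℝ, ContDiff ℝ ∞ G ∧ (∀ t, F t = t * G t) ∧ G 0 = deriv F 0 ∧
      (F.Odd → G.Even) ∧ (F.Even → G.Odd) := by
  have hF' : ContDiff ℝ ∞ (deriv F) := (contDiff_infty_iff_deriv.1 hF).2
  have hFt : ∀ t, HasDerivAt F (deriv F t) t := fun t =>
    (hF.differentiable (by simp)).differentiableAt.hasDerivAt
  -- The quotient comes from integrating `d/ds F(s t) = t F'(s t)` over `[0, 1]`.
  let G : ℝ → ℝ := fun t => ∫ s in (0 : ℝ)..1, deriv F (s * t)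
  have hG : ContDiff ℝ ∞ G := by simpa using contDiff_integral_pow_mul hF' 0
  have hmul : ∀ t, F t = t * G t := by
    intro t
    have h1 : ∀ s ∈ Set.uIcc (0 : ℝ) 1,
        HasDerivAt (fun s => F (s * t)) (t * deriv F (s * t)) s := by
      intro s _
      have h2 : HasDerivAt (fun s : ℝ => s * t) t s := by
        simpa using (hasDerivAt_id s).mul_const t
      simpa [mul_comm, Function.comp_def] using (hFt (s * t)).comp s h2
    have h3 := intervalIntegral.integral_eq_sub_of_hasDerivAt h1
      (Continuous.intervalIntegrable (by have := hF'.continuous; fun_prop) _ _)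
    rw [intervalIntegral.integral_const_mul] at h3
    simp only [zero_mul, one_mul, h0, sub_zero] at h3
    exact h3.symm
  refine ⟨G, hG, hmul, by simp [G], fun ho t => ?_, fun he t => ?_⟩
  · rcases eq_or_ne t 0 with rfl | ht
    · simp
    · have h1 := ho t
      rw [hmul, hmul t] at h1
      have : t * (G (-t) - G t) = 0 := by linarith
      simpa [ht, sub_eq_zero] using this
  · have hn : ∀ t ≠ 0, G (-t) = -G t := by
      intro t ht
      have h1 := he t
      rw [hmul, hmul t] at h1
      have : t * (G (-t) + G t) = 0 := by linarith
      simpa [ht, add_eq_zero_iff_eq_neg] using this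
    -- Division by `t` says nothing at `0`; oddness there follows by continuity.
    rcases eq_or_ne t 0 with rfl | ht
    · have h1 : Continuous fun t => G (-t) := hG.continuous.comp continuous_neg
      have h2 : Continuous fun t => -G t := hG.continuous.neg
      have := h1.ext_on (dense_compl_singleton (0 : ℝ)) h2 hn
      exact congrFun this 0
    · exact hn t ht

theorem Function.Even.deriv_odd {F : ℝ → ℝ} (hF : F.Even) : (deriv F).Odd := by
  intro t
  have h1 : (fun t => F (-t)) = F := funext hF
  have h2 := deriv_comp_neg F t
  rw [h1] at h2
  rw [h2, neg_neg]

/-- Since `F'` is odd, `F'(t) = t G(t)` with `G` smooth and even, so the gradient of `F ‖v‖` is `G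
‖v‖ • v`, with no singularity left. Induction on the order then applies to `G`. -/
theorem contDiff_comp_norm {V : Type*} [NormedAddCommGroup V] [InnerProductSpace ℝ V]
    {F : ℝ → ℝ} (hF : ContDiff ℝ ∞ F) (he : F.Even) : ContDiff ℝ ∞ fun v : V => F ‖v‖ := by
  rw [contDiff_infty]
  intro n
  induction n generalizing F with
  | zero => exact contDiff_zero.2 (hF.continuous.comp continuous_norm)
  | succ n ih =>
    have hF' : ContDiff ℝ ∞ (deriv F) := (contDiff_infty_iff_deriv.1 hF).2
    have hFt : ∀ t, HasDerivAt F (deriv F t) t := fun t =>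
      (hF.differentiable (by simp)).differentiableAt.hasDerivAt
    obtain ⟨G, hG, hmul, -, hGe, -⟩ := exists_contDiff_eq_mul hF' he.deriv_odd.map_zero
    rw [Nat.cast_add, Nat.cast_one, contDiff_succ_iff_hasFDerivAt]
    refine ⟨fun v => G ‖v‖ • innerSL ℝ v,
      (ih hG (hGe he.deriv_odd)).smul (innerSL ℝ).contDiff, fun v => ?_⟩
    rcases eq_or_ne v 0 with rfl | hv
    -- The norm is not differentiable at `0`; `F'(0) = 0` gives the required little-o directly.
    · have h1 := hFt 0
      rw [he.deriv_odd.map_zero, hasDerivAt_iff_isLittleO_nhds_zero] at h1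
      rw [hasFDerivAt_iff_isLittleO_nhds_zero]
      have h2 : Filter.Tendsto (fun v : V => ‖v‖) (nhds 0) (nhds 0) := tendsto_norm_zero
      have h3 := Asymptotics.isLittleO_norm_right.1 (h1.comp_tendsto h2)
      simpa [Function.comp_def] using h3
    · have h1 : HasFDerivAt (fun v : V => ‖v‖ ^ 2) (2 • innerSL ℝ v) v :=
        (hasStrictFDerivAt_norm_sq v).hasFDerivAt
      have hn : ‖v‖ ≠ 0 := norm_ne_zero_iff.2 hv
      have h2 := h1.sqrt (by positivity)
      simp only [Real.sqrt_sq (norm_nonneg _)] at h2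
      have h3 := (hFt ‖v‖).comp_hasFDerivAt v h2
      convert! h3 using 1
      rw [hmul]
      ext w
      simp
      field_simp
namespace CohomOne

/-! ### Tangent vectors and bilinear fields in coordinates

The tangent spaces of `M` are copies of `E`; here linear maps on them are given the type of linear
maps on `E`, which carries a norm. -/

/-- The coordinate isomorphism `E → T_p M` determined by the chart at `p₀`. -/
def coordFrame (p₀ p : M) : E →L[ℝ] E :=
  (trivializationAt E (TangentSpace I : M → Type _) p₀).symmL ℝ p

/-- The value of a bilinear field at `p`, as a bilinear form on `E`. -/
def fiberForm (Ω : BilinField) (p : M) : E →L[ℝ] E →L[ℝ] ℝ := Ω p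

theorem eventually_mem_baseSet (p₀ : M) :
    ∀ᶠ p in nhds p₀, p ∈ (trivializationAt E (TangentSpace I : M → Type _) p₀).baseSet :=
  (trivializationAt E (TangentSpace I : M → Type _) p₀).open_baseSet.mem_nhds
    (FiberBundle.mem_baseSet_trivializationAt' p₀)

/-- The differential of `emb`. -/
def dEmb (p : M) : E →L[ℝ] ℍ[ℝ] × su2 := mfderiv I 𝓘(ℝ, ℍ[ℝ] × su2) emb p

theorem contMDiffAt_dEmb (p₀ : M) :
    ContMDiffAt I 𝓘(ℝ, E →L[ℝ] ℍ[ℝ] × su2) ∞ (fun p => (dEmb p).comp (coordFrame p₀ p)) p₀ := by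
  have h := (contMDiff_emb p₀).mfderiv_const (m := ∞) le_rfl
  refine h.congr_of_eventuallyEq (Filter.Eventually.of_forall fun p => ?_)
  refine ContinuousLinearMap.ext fun v => ?_
  simp [inTangentCoordinates, ContinuousLinearMap.inCoordinates, dEmb, coordFrame]
  rfl

/-- Replaces smoothness of a section of a nested hom bundle by smoothness of a map into one fixed
normed space, where the usual calculus applies. -/
theorem contMDiffWithinAt_bilinField_iff {Ω : BilinField} {U : Set M} {p₀ : M} :
    ContMDiffWithinAt I (I.prod 𝓘(ℝ, E →L[ℝ] E →L[ℝ] ℝ)) ∞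
      (fun p : M => Bundle.TotalSpace.mk' (E →L[ℝ] E →L[ℝ] ℝ) p (Ω p)) U p₀ ↔
    ContMDiffWithinAt I 𝓘(ℝ, E →L[ℝ] E →L[ℝ] ℝ) ∞
      (fun p => (fiberForm Ω p).bilinearComp (coordFrame p₀ p) (coordFrame p₀ p)) U p₀ := by
  rw [contMDiffWithinAt_hom_bundle]
  have key : ∀ p ∈ (trivializationAt E (TangentSpace I : M → Type _) p₀).baseSet,
      ContinuousLinearMap.inCoordinates E (TangentSpace I : M → Type _) (E →L[ℝ] ℝ)
        (fun p : M => TangentSpace I p →L[ℝ] ℝ) p₀ p p₀ p (Ω p) =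
      (fiberForm Ω p).bilinearComp (coordFrame p₀ p) (coordFrame p₀ p) := by
    intro p hp
    refine ContinuousLinearMap.ext fun v => ContinuousLinearMap.ext fun w => ?_
    refine (inCoordinates_apply_eq₂ (E₃ := fun _ : M => ℝ) hp hp
      (Set.mem_univ _)).trans ?_
    have e : ∀ u : E, coordFrame p₀ p u =
        (trivializationAt E (TangentSpace I : M → Type _) p₀).symm p u :=
      Bundle.Trivialization.symmL_apply _ hp
    rw [ContinuousLinearMap.bilinearComp_apply, e, e]
    simp
    rfl
  have ev : ∀ᶠ p in nhdsWithin p₀ U, ContinuousLinearMap.inCoordinates E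
        (TangentSpace I : M → Type _) (E →L[ℝ] ℝ)
        (fun p : M => TangentSpace I p →L[ℝ] ℝ) p₀ p p₀ p (Ω p) =
      (fiberForm Ω p).bilinearComp (coordFrame p₀ p) (coordFrame p₀ p) :=
    ((eventually_mem_baseSet p₀).mono key).filter_mono nhdsWithin_le_nhds
  have e0 := key p₀ (FiberBundle.mem_baseSet_trivializationAt' p₀)
  constructor
  · rintro ⟨-, h⟩
    exact h.congr_of_eventuallyEq (ev.mono fun p hp => hp.symm) e0.symm
  · intro h
    exact ⟨contMDiffWithinAt_id, h.congr_of_eventuallyEq ev e0⟩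

/-! ### The Maurer-Cartan trivialization of `TM` -/

/-- `(q, w) ↦ (Im (x̄ q), w)`. -/
def leftDiv (x : ℍ[ℝ]) : ℍ[ℝ] × su2 →L[ℝ] su2 × su2 :=
  (ContinuousLinearMap.inl ℝ su2 su2).comp (imProj.comp
      ((ContinuousLinearMap.mul ℝ ℍ[ℝ] (star x)).comp (ContinuousLinearMap.fst ℝ ℍ[ℝ] su2))) +
    (ContinuousLinearMap.inr ℝ su2 su2).comp (ContinuousLinearMap.snd ℝ ℍ[ℝ] su2)

@[simp] theorem leftDiv_apply (x : ℍ[ℝ]) (z : ℍ[ℝ] × su2) :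
    leftDiv x z = (imProj (star x * z.1), z.2) := by
  simp [leftDiv]

theorem contDiff_star_quaternion : ContDiff ℝ ∞ (star : ℍ[ℝ] → ℍ[ℝ]) :=
  (LinearMap.toContinuousLinearMap
    { toFun := (star : ℍ[ℝ] → ℍ[ℝ])
      map_add' := star_add
      map_smul' := fun c a => by ext <;> simp }).contDiff

theorem contDiff_leftDiv : ContDiff ℝ ∞ leftDiv := by
  have h1 : ContDiff ℝ ∞ fun x : ℍ[ℝ] => ContinuousLinearMap.mul ℝ ℍ[ℝ] (star x) :=
    (ContinuousLinearMap.contDiff _).comp contDiff_star_quaternion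
  unfold leftDiv
  exact (contDiff_const.clm_comp
    (contDiff_const.clm_comp (h1.clm_comp contDiff_const))).add contDiff_const

/-- The left Maurer-Cartan form of `S³` together with the differential of the fibre coordinate. -/
def theta (p : M) : E →L[ℝ] su2 × su2 :=
  (leftDiv (emb p).1).comp (dEmb p)

theorem contMDiffAt_theta (p₀ : M) :
    ContMDiffAt I 𝓘(ℝ, E →L[ℝ] su2 × su2) ∞ (fun p => (theta p).comp (coordFrame p₀ p)) p₀ := by
  have h0 : ContMDiffAt I 𝓘(ℝ, ℍ[ℝ]) ∞ (fun p => (emb p).1) p₀ :=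
    contDiff_fst.comp_contMDiffAt (contMDiff_emb p₀)
  have h1 : ContMDiffAt I 𝓘(ℝ, ℍ[ℝ] × su2 →L[ℝ] su2 × su2) ∞ (fun p => leftDiv (emb p).1) p₀ :=
    contDiff_leftDiv.comp_contMDiffAt h0
  simpa only [theta, ContinuousLinearMap.comp_assoc] using h1.clm_comp (contMDiffAt_dEmb p₀)

theorem star_mul_self_sphere (x : SU2) : star (x : ℍ[ℝ]) * (x : ℍ[ℝ]) = 1 := by
  rw [← coe_inv_eq_star, ← Metric.unitSphere.coe_mul, inv_mul_cancel, Metric.unitSphere.coe_one]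

theorem self_mul_star_sphere (x : SU2) : (x : ℍ[ℝ]) * star (x : ℍ[ℝ]) = 1 := by
  rw [← coe_inv_eq_star, ← Metric.unitSphere.coe_mul, mul_inv_cancel, Metric.unitSphere.coe_one]

theorem exists_curve (p : M) (z : su2 × su2) : ∃ c : ℝ → M, c 0 = p ∧
    ContDiff ℝ ∞ (emb ∘ c) ∧ HasDerivAt (emb ∘ c) ((emb p).1 * (z.1 : ℍ[ℝ]), z.2) 0 := by
  let c : ℝ → M := fun s => triv.symm ((triv p).1 * expSU2 (s • z.1), (triv p).2 + s • z.2)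
  have hc : emb ∘ c =
      fun s : ℝ => ((emb p).1 * NormedSpace.exp (s • (z.1 : ℍ[ℝ])), (emb p).2 + s • z.2) := by
    funext s
    simp only [emb, Function.comp, c, Homeomorph.apply_symm_apply, Metric.unitSphere.coe_mul]
    rfl
  refine ⟨c, ?_, ?_, ?_⟩
  · have h1 : expSU2 0 = 1 := by
      apply Subtype.ext
      simp [expSU2]
    simp [c, h1]
  · rw [hc]
    exact (contDiff_const.mul (contDiff_exp_smul _)).prodMk
      (contDiff_const.add (contDiff_id.smul contDiff_const))
  · rw [hc]
    have h2 : HasDerivAt (fun s : ℝ => (emb p).2 + s • z.2) z.2 0 := by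
      simpa using ((hasDerivAt_id (0 : ℝ)).smul_const z.2).const_add (emb p).2
    exact ((hasDerivAt_exp_smul_zero (z.1 : ℍ[ℝ])).const_mul (emb p).1).prodMk h2

/-- The value `z` is attained by the velocity of `s ↦ (x exp(s z₁), v + s z₂)`. As both sides have
dimension six, surjectivity is enough for `thetaEquiv`. -/
theorem theta_surjective (p : M) : Function.Surjective (theta p) := by
  intro z
  obtain ⟨c, rfl, h1, h2⟩ := exists_curve p z
  refine ⟨mfderiv 𝓘(ℝ, ℝ) I c 0 (1 : ℝ), ?_⟩
  have h3 : dEmb (c 0) (mfderiv 𝓘(ℝ, ℝ) I c 0 (1 : ℝ)) = _ := mfderiv_emb_curve h1 h2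
  change leftDiv (emb (c 0)).1 (dEmb (c 0) _) = z
  rw [h3, leftDiv_apply, ← mul_assoc]
  have h4 : star (emb (c 0)).1 * (emb (c 0)).1 = 1 := star_mul_self_sphere _
  rw [h4, one_mul, imProj_coe]

theorem finrank_E : Module.finrank ℝ E = 6 := by
  rw [Module.finrank_prod, finrank_su2]
  simp

/-- `theta` as an isomorphism. -/
def thetaEquiv (p : M) : E ≃L[ℝ] su2 × su2 :=
  ContinuousLinearEquiv.ofBijective (theta p)
    (LinearMap.ker_eq_bot.2 ((LinearMap.injective_iff_surjective_of_finrank_eq_finrank (by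
      rw [finrank_E, Module.finrank_prod, finrank_su2])).2 (theta_surjective p)))
    (LinearMap.range_eq_top.2 (theta_surjective p))

@[simp] theorem thetaEquiv_apply (p : M) (v : E) :
    thetaEquiv p v = theta p v := rfl

@[simp] theorem theta_thetaEquiv_symm (p : M) (z : su2 × su2) :
    theta p ((thetaEquiv p).symm z) = z := (thetaEquiv p).apply_symm_apply z

@[simp] theorem thetaEquiv_symm_theta (p : M) (v : E) :
    (thetaEquiv p).symm (theta p v) = v := (thetaEquiv p).symm_apply_apply v

/-- Bilinear forms on `𝔰𝔲₂ ⊕ 𝔰𝔲₂`. -/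
abbrev Bilin : Type := su2 × su2 →L[ℝ] su2 × su2 →L[ℝ] ℝ

/-- The bilinear field whose matrix in the Maurer-Cartan trivialization is `β`. -/
def ofMatrix (β : M → Bilin) : BilinField := fun p =>
  ((β p).bilinearComp (theta p) (theta p) : E →L[ℝ] E →L[ℝ] ℝ)

@[simp] theorem ofMatrix_apply (β : M → Bilin) (p : M) (v w : E) :
    fiberForm (ofMatrix β) p v w = β p (theta p v) (theta p w) := rfl

/-- The matrix of a bilinear field in the Maurer-Cartan trivialization. -/
def toMatrix (Ω : BilinField) (p : M) : Bilin :=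
  (fiberForm Ω p).bilinearComp ((thetaEquiv p).symm : su2 × su2 →L[ℝ] E)
    ((thetaEquiv p).symm : su2 × su2 →L[ℝ] E)

theorem toMatrix_apply (Ω : BilinField) (p : M) (z w : su2 × su2) :
    toMatrix Ω p z w = fiberForm Ω p ((thetaEquiv p).symm z) ((thetaEquiv p).symm w) := rfl

theorem toMatrix_theta (Ω : BilinField) (p : M) (v w : E) :
    toMatrix Ω p (theta p v) (theta p w) = fiberForm Ω p v w := by
  rw [toMatrix_apply, thetaEquiv_symm_theta, thetaEquiv_symm_theta]

theorem contMDiffWithinAt_bilinearComp {V W : Type*} [NormedAddCommGroup V] [NormedSpace ℝ V]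
    [NormedAddCommGroup W] [NormedSpace ℝ W] {B : M → W →L[ℝ] W →L[ℝ] ℝ} {L : M → V →L[ℝ] W}
    {U : Set M} {p : M} (hB : ContMDiffWithinAt I 𝓘(ℝ, W →L[ℝ] W →L[ℝ] ℝ) ∞ B U p)
    (hL : ContMDiffWithinAt I 𝓘(ℝ, V →L[ℝ] W) ∞ L U p) :
    ContMDiffWithinAt I 𝓘(ℝ, V →L[ℝ] V →L[ℝ] ℝ) ∞
      (fun p => (B p).bilinearComp (L p) (L p)) U p := by
  have h1 : ContMDiffWithinAt I 𝓘(ℝ, W →L[ℝ] V →L[ℝ] ℝ) ∞ (fun p => ((B p).comp (L p)).flip) U p :=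
    ContDiff.comp_contMDiffWithinAt
      (ContinuousLinearMap.flipₗᵢ ℝ V W ℝ).toContinuousLinearEquiv.contDiff (hB.clm_comp hL)
  exact ContDiff.comp_contMDiffWithinAt
    (ContinuousLinearMap.flipₗᵢ ℝ V V ℝ).toContinuousLinearEquiv.contDiff (h1.clm_comp hL)

theorem contMDiff_ofMatrix {β : M → Bilin} (hβ : ContMDiff I 𝓘(ℝ, Bilin) ∞ β) :
    ContMDiff I (I.prod 𝓘(ℝ, E →L[ℝ] E →L[ℝ] ℝ)) ∞
      (fun p : M => Bundle.TotalSpace.mk' (E →L[ℝ] E →L[ℝ] ℝ) p (ofMatrix β p)) := by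
  intro p₀
  refine contMDiffWithinAt_bilinField_iff.2 ?_
  have h := contMDiffWithinAt_bilinearComp (hβ p₀).contMDiffWithinAt
    (contMDiffAt_theta p₀).contMDiffWithinAt (U := Set.univ)
  exact h

/-- In a chart the matrix is the local bilinear form composed with the inverse of `theta`, and
operator inversion is smooth at an invertible operator. -/
theorem contMDiff_toMatrix {Ω : BilinField} (hΩ : IsTwoFormOn Ω Set.univ) :
    ContMDiff I 𝓘(ℝ, Bilin) ∞ (toMatrix Ω) := by
  intro p₀
  have h1 := contMDiffWithinAt_bilinField_iff.1 (hΩ.smooth p₀ (Set.mem_univ _))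
  have key : ∀ p ∈ (trivializationAt E (TangentSpace I : M → Type _) p₀).baseSet,
      ∃ e : E ≃L[ℝ] su2 × su2, (e : E →L[ℝ] su2 × su2) = (theta p).comp (coordFrame p₀ p) ∧
      toMatrix Ω p = ((fiberForm Ω p).bilinearComp (coordFrame p₀ p) (coordFrame p₀ p)).bilinearComp
        ((theta p).comp (coordFrame p₀ p)).inverse ((theta p).comp (coordFrame p₀ p)).inverse := by
    intro p hp
    let e : E ≃L[ℝ] su2 × su2 :=
      ((trivializationAt E (TangentSpace I : M → Type _) p₀).continuousLinearEquivAt ℝ p hp).symm.trans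
        (thetaEquiv p)
    have he : (e : E →L[ℝ] su2 × su2) = (theta p).comp (coordFrame p₀ p) := by
      refine ContinuousLinearMap.ext fun v => ?_
      exact congrArg (theta p) (congrFun
        (Bundle.Trivialization.symm_continuousLinearEquivAt_eq _ hp) v)
    refine ⟨e, he, ?_⟩
    have hc : ∀ z, coordFrame p₀ p (e.symm z) = (thetaEquiv p).symm z := by
      intro z
      have h2 : theta p (coordFrame p₀ p (e.symm z)) = z := by
        rw [← ContinuousLinearMap.comp_apply, ← he]
        simp
      rw [← h2, thetaEquiv_symm_theta, h2]
    rw [← he, ContinuousLinearMap.inverse_equiv]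
    refine ContinuousLinearMap.ext fun z => ContinuousLinearMap.ext fun w => ?_
    simp only [ContinuousLinearMap.bilinearComp_apply, ContinuousLinearEquiv.coe_coe, hc,
      toMatrix_apply]
  obtain ⟨e₀, he₀, hk₀⟩ := key p₀ (FiberBundle.mem_baseSet_trivializationAt' p₀)
  have h2 : ContMDiffAt I 𝓘(ℝ, su2 × su2 →L[ℝ] E) ∞
      (fun p => ((theta p).comp (coordFrame p₀ p)).inverse) p₀ := by
    have h3 : ContDiffAt ℝ ∞ (ContinuousLinearMap.inverse : (E →L[ℝ] su2 × su2) → _)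
        ((theta p₀).comp (coordFrame p₀ p₀)) := he₀ ▸ contDiffAt_map_inverse e₀
    exact h3.contMDiffAt.comp p₀ (contMDiffAt_theta p₀)
  have h4 := contMDiffWithinAt_bilinearComp h1 (h2.contMDiffWithinAt (s := Set.univ))
  rw [contMDiffWithinAt_univ] at h4
  exact h4.congr_of_eventuallyEq ((eventually_mem_baseSet p₀).mono fun p hp =>
    (key p hp).choose_spec.2)

/-! ### The action of `G` in the Maurer-Cartan trivialization -/

theorem coe_Ad (b : SU2) (x : su2) : (Ad b x : ℍ[ℝ]) = b * x * star (b : ℍ[ℝ]) := by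
  rw [← coe_inv_eq_star]
  rfl

/-- The adjoint representation as a continuous linear map. -/
def AdL (b : SU2) : su2 →L[ℝ] su2 :=
  LinearMap.toContinuousLinearMap
    { toFun := Ad b
      map_add' := fun x y => by
        apply Subtype.ext
        simp [coe_Ad, mul_add, add_mul]
      map_smul' := fun c x => by
        apply Subtype.ext
        simp [coe_Ad] }

@[simp] theorem AdL_apply (b : SU2) (x : su2) : AdL b x = Ad b x := rfl

/-- The diagonal adjoint representation on `𝔰𝔲₂ ⊕ 𝔰𝔲₂`. -/
def AdP (b : SU2) : su2 × su2 →L[ℝ] su2 × su2 := (AdL b).prodMap (AdL b)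

@[simp] theorem AdP_apply (b : SU2) (z : su2 × su2) : AdP b z = (Ad b z.1, Ad b z.2) := rfl

theorem AdP_surjective (b : SU2) : Function.Surjective (AdP b) := fun z =>
  ⟨(Ad b⁻¹ z.1, Ad b⁻¹ z.2), by simp [← Ad_mul, Ad_one]⟩

theorem triv_smul (a : G) (p : M) :
    triv (a • p) = (a.1 * (triv p).1 * a.2⁻¹, Ad a.2 (triv p).2) := by
  induction p using Quotient.inductionOn with
  | _ p =>
    obtain ⟨g, v⟩ := p
    change (a.1 * g.1 * (a.2 * g.2)⁻¹, Ad (a.2 * g.2) v) =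
      (a.1 * (g.1 * g.2⁻¹) * a.2⁻¹, Ad a.2 (Ad g.2 v))
    rw [Ad_mul]
    simp only [mul_inv_rev, mul_assoc]

/-- The linear extension to `ℍ × 𝔰𝔲₂` of the action of `a ∈ G`. -/
def actL (a : G) : ℍ[ℝ] × su2 →L[ℝ] ℍ[ℝ] × su2 :=
  ((ContinuousLinearMap.mul ℝ ℍ[ℝ]).flip (star (a.2 : ℍ[ℝ])) ∘L
    ContinuousLinearMap.mul ℝ ℍ[ℝ] (a.1 : ℍ[ℝ])).prodMap (AdL a.2)

theorem actL_apply (a : G) (z : ℍ[ℝ] × su2) :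
    actL a z = ((a.1 : ℍ[ℝ]) * z.1 * star (a.2 : ℍ[ℝ]), Ad a.2 z.2) := rfl

theorem emb_smul (a : G) (p : M) : emb (a • p) = actL a (emb p) := by
  rw [actL_apply, emb, triv_smul]
  simp only [Metric.unitSphere.coe_mul, coe_inv_eq_star]
  rfl

theorem contMDiff_of_emb {f : M → M} (h : ContMDiff I 𝓘(ℝ, ℍ[ℝ] × su2) ∞ (emb ∘ f)) :
    ContMDiff I I ∞ f := by
  have h1 : ContMDiff I 𝓘(ℝ, ℍ[ℝ]) ∞ fun p => ((triv (f p)).1 : ℍ[ℝ]) :=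
    ContDiff.comp_contMDiff (g := Prod.fst) (f := emb ∘ f) contDiff_fst h
  have h2 : ContMDiff I 𝓘(ℝ, su2) ∞ fun p => (triv (f p)).2 :=
    ContDiff.comp_contMDiff (g := Prod.snd) (f := emb ∘ f) contDiff_snd h
  have h3 : ContMDiff I (𝓡 3) ∞ fun p => (triv (f p)).1 :=
    h1.codRestrict_sphere fun p => (triv (f p)).1.2
  have h4 : ContMDiff I I ∞ fun p => triv (f p) := h3.prodMk h2
  have h5 := contMDiff_triv_symm.comp h4
  have h6 : triv.symm ∘ (fun p => triv (f p)) = f := by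
    funext p
    simp
  rwa [h6] at h5

theorem contMDiff_smul_left (a : G) : ContMDiff I I ∞ fun p : M => a • p := by
  refine contMDiff_of_emb ?_
  have h : emb ∘ (fun p : M => a • p) = fun p => actL a (emb p) := funext (emb_smul a)
  rw [h]
  exact (actL a).contDiff.comp_contMDiff contMDiff_emb

theorem dEmb_smul (a : G) (p : M) (v : TangentSpace I p) :
    dEmb (a • p) (mfderiv I I (fun q : M => a • q) p v) = actL a (dEmb p v) := by
  have h1 : MDifferentiableAt I 𝓘(ℝ, ℍ[ℝ] × su2) emb (a • p) :=
    (contMDiff_emb _).mdifferentiableAt (by simp)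
  have h2 : MDifferentiableAt I I (fun q : M => a • q) p :=
    (contMDiff_smul_left a p).mdifferentiableAt (by simp)
  have h3 : MDifferentiableAt I 𝓘(ℝ, ℍ[ℝ] × su2) emb p :=
    (contMDiff_emb _).mdifferentiableAt (by simp)
  have h4 : MDifferentiableAt 𝓘(ℝ, ℍ[ℝ] × su2) 𝓘(ℝ, ℍ[ℝ] × su2) (actL a) (emb p) :=
    (actL a).differentiableAt.mdifferentiableAt
  have h5 := mfderiv_comp_apply p h1 h2 v
  have h6 := mfderiv_comp_apply p h4 h3 v
  have h7 : emb ∘ (fun p : M => a • p) = actL a ∘ emb := funext (emb_smul a)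
  rw [h7, h6, mfderiv_eq_fderiv, ContinuousLinearMap.fderiv] at h5
  exact h5.symm

theorem imProj_conj (b : SU2) (q : ℍ[ℝ]) :
    imProj (b * q * star (b : ℍ[ℝ])) = Ad b (imProj q) := by
  have hq : q = (q.re : ℍ[ℝ]) + (imProj q : ℍ[ℝ]) := (Quaternion.re_add_im q).symm
  have h1 : (b : ℍ[ℝ]) * q * star (b : ℍ[ℝ]) = (q.re : ℍ[ℝ]) + (Ad b (imProj q) : ℍ[ℝ]) := by
    rw [coe_Ad]
    nth_rw 1 [hq]
    rw [mul_add, add_mul, ← Quaternion.coe_commutes, mul_assoc, self_mul_star_sphere, mul_one]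
  have h2 : imProj (q.re : ℍ[ℝ]) = 0 := by
    apply Subtype.ext
    simp [imProj]
  rw [h1, map_add, imProj_coe, h2, zero_add]

/-- The group coordinate moves by `x ↦ a₁ x a₂⁻¹`: the left factor cancels in `x̄ dx`, and the right
factor leaves conjugation by `a₂`. -/
theorem theta_smul (a : G) (p : M) (v : TangentSpace I p) :
    theta (a • p) (mfderiv I I (fun q : M => a • q) p v) = AdP a.2 (theta p v) := by
  change leftDiv (emb (a • p)).1 (dEmb (a • p) _) = AdP a.2 (leftDiv (emb p).1 (dEmb p v))
  rw [dEmb_smul, emb_smul, actL_apply, actL_apply, leftDiv_apply, leftDiv_apply, AdP_apply,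
    ← imProj_conj]
  have h : star (a.1 : ℍ[ℝ]) * (a.1 : ℍ[ℝ]) = 1 := star_mul_self_sphere _
  simp only [star_mul, star_star, mul_assoc]
  rw [← mul_assoc (star (a.1 : ℍ[ℝ])), h, one_mul]

theorem toMatrix_smul {Ω : BilinField} {U : Set M} (hΩ : IsInvariantOn Ω U) (a : G) {p : M}
    (hp : p ∈ U) (z w : su2 × su2) :
    toMatrix Ω (a • p) (AdP a.2 z) (AdP a.2 w) = toMatrix Ω p z w := by
  obtain ⟨v, rfl⟩ := theta_surjective p z
  obtain ⟨u, rfl⟩ := theta_surjective p w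
  have h := hΩ a p hp v u
  rw [toMatrix_theta]
  refine Eq.trans ?_ h
  have h1 := theta_smul a p v
  have h2 := theta_smul a p u
  rw [← h1, ← h2]
  exact toMatrix_theta _ _ _ _

/-! ### The singular orbit, and representatives of the orbits on `γ` -/

theorem mk_diag (b : SU2) (v : su2) : ((b, b) : G) • mk 1 v = mk 1 (Ad b v) := by
  apply triv.injective
  rw [triv_smul]
  change (b * (1 * 1⁻¹) * b⁻¹, Ad b (Ad 1 v)) = (1 * 1⁻¹, Ad 1 (Ad b v))
  simp [Ad_one]

theorem triv_mk_one (v : su2) : triv (mk 1 v) = (1, v) := trivFun_mk_one (1, v)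

theorem mem_S_iff {p : M} : p ∈ S ↔ (triv p).2 = 0 := by
  have h0 : triv (γ 0) = (1, 0) := by rw [γ, triv_mk_one, zero_smul]
  constructor
  · rintro ⟨a, rfl⟩
    change (triv (a • γ 0)).2 = 0
    rw [triv_smul, h0]
    exact (AdL a.2).map_zero
  · intro h
    refine ⟨((triv p).1, 1), triv.injective ?_⟩
    change triv (((triv p).1, (1 : SU2)) • γ 0) = _
    rw [triv_smul, h0]
    ext1
    · simp
    · simpa [h] using (AdL 1).map_zero

theorem mk_one_mem_compl_S {v : su2} : mk 1 v ∈ Sᶜ ↔ v ≠ 0 := by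
  rw [Set.mem_compl_iff, mem_S_iff, triv_mk_one]

theorem vecH_ne_zero : vecH ≠ 0 := by
  intro h
  have := congrArg (fun x : su2 => (x : ℍ[ℝ]).imI) h
  simp [vecH_coords] at this

theorem γ_mem_compl_S {t : ℝ} (ht : t ≠ 0) : γ t ∈ Sᶜ :=
  mk_one_mem_compl_S.2 (smul_ne_zero ht vecH_ne_zero)

/-- Every imaginary quaternion is conjugate to a nonnegative multiple of `vecH`. -/
theorem exists_Ad_smul_vecH (v : su2) : ∃ b : SU2, Ad b ((2 * ‖v‖) • vecH) = v := by
  suffices h : ∃ b : SU2, (b : ℍ[ℝ]) * (((2 * ‖v‖) • vecH : su2) : ℍ[ℝ]) = v * b by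
    obtain ⟨b, hb⟩ := h
    refine ⟨b, Subtype.ext ?_⟩
    rw [coe_Ad, hb, mul_assoc, self_mul_star_sphere, mul_one]
  have hre := re_coe_su2 v
  have hn : ‖v‖ * ‖v‖ = (v : ℍ[ℝ]).imI ^ 2 + (v : ℍ[ℝ]).imJ ^ 2 + (v : ℍ[ℝ]).imK ^ 2 := by
    change ‖(v : ℍ[ℝ])‖ * ‖(v : ℍ[ℝ])‖ = _
    rw [← Quaternion.normSq_eq_norm_mul_self, Quaternion.normSq_def', hre]
    ring
  obtain ⟨a1, a2, a3⟩ := vecH_coords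
  have a0 := re_coe_su2 vecH
  generalize ‖v‖ = r at *
  -- With `h = 2r • vecH`, both `v` and `h` square to `-r²`, so `q = v + h` satisfies `q h = v q`.
  -- It vanishes only for `v = -h`, where conjugation by `j` serves instead.
  let q : ℍ[ℝ] := v + (((2 * r) • vecH : su2) : ℍ[ℝ])
  have hq : q * (((2 * r) • vecH : su2) : ℍ[ℝ]) = v * q := by
    ext <;> simp [q, a0, a1, a2, a3, hre] <;> nlinarith
  rcases eq_or_ne q 0 with h0 | h0
  · obtain ⟨j, j0, j1, j2, j3⟩ : ∃ j : ℍ[ℝ], j.re = 0 ∧ j.imI = 0 ∧ j.imJ = 1 ∧ j.imK = 0 :=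
      ⟨⟨0, 0, 1, 0⟩, rfl, rfl, rfl, rfl⟩
    refine ⟨⟨j, ?_⟩, ?_⟩
    · rw [mem_sphere_zero_iff_norm, ← sq_eq_sq₀ (norm_nonneg _) zero_le_one, sq,
        ← Quaternion.normSq_eq_norm_mul_self, Quaternion.normSq_def', j0, j1, j2, j3]
      norm_num
    · have hv : (v : ℍ[ℝ]) = -(((2 * r) • vecH : su2) : ℍ[ℝ]) := eq_neg_of_add_eq_zero_left h0
      rw [hv]
      ext <;> simp [a0, a1, a2, a3, j0, j1, j2, j3]
  · refine ⟨⟨‖q‖⁻¹ • q, ?_⟩, ?_⟩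
    · rw [mem_sphere_zero_iff_norm, norm_smul, norm_inv, norm_norm,
        inv_mul_cancel₀ (norm_ne_zero_iff.2 h0)]
    · change (‖q‖⁻¹ • q) * _ = _ * (‖q‖⁻¹ • q)
      rw [smul_mul_assoc, mul_smul_comm, hq]

theorem exists_smul_γ (p : M) : ∃ (a : G) (t : ℝ), 0 ≤ t ∧ a • γ t = p ∧
    t = 2 * ‖(triv p).2‖ ∧ Ad a.2 (t • vecH) = (triv p).2 := by
  obtain ⟨b, hb⟩ := exists_Ad_smul_vecH (triv p).2
  refine ⟨((triv p).1 * b, b), 2 * ‖(triv p).2‖, by positivity, triv.injective ?_, rfl, hb⟩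
  rw [triv_smul, γ, triv_mk_one]
  ext1
  · simp
  · exact hb

/-! ### The frame along `γ` -/

/-- The frame along `γ` in the Maurer-Cartan trivialization. -/
def thetaFrame (t : ℝ) : Fin 6 → su2 × su2 :=
  ![(0, vecH), ((2 : ℝ) • vecH, 0), (vecE, 0), (vecV, 0), (-vecE, -(t • vecV)), (-vecV, t • vecE)]

theorem theta_γ (t : ℝ) (v : TangentSpace I (γ t)) :
    theta (γ t) v = (imProj (dEmb (γ t) v).1, (dEmb (γ t) v).2) := by
  change leftDiv (emb (γ t)).1 (dEmb (γ t) v) = _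
  rw [leftDiv_apply, emb_γ]
  simp

theorem theta_fundamental (X : su2 × su2) (t : ℝ) :
    theta (γ t) (fundamental X (γ t)) = (X.1 - X.2, t • bracket X.2 vecH) := by
  have h : dEmb (γ t) (fundamental X (γ t)) = _ := emb_fundamental X t
  rw [theta_γ, h]
  exact congrArg (·, t • bracket X.2 vecH) (imProj_coe (X.1 - X.2))

theorem su2_ext {x y : su2} (h1 : (x : ℍ[ℝ]).imI = (y : ℍ[ℝ]).imI)
    (h2 : (x : ℍ[ℝ]).imJ = (y : ℍ[ℝ]).imJ) (h3 : (x : ℍ[ℝ]).imK = (y : ℍ[ℝ]).imK) : x = y :=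
  Subtype.ext (QuaternionAlgebra.ext ((re_coe_su2 x).trans (re_coe_su2 y).symm) h1 h2 h3)

theorem bracket_vecE_vecH : bracket vecE vecH = -vecV := by
  obtain ⟨a1, a2, a3⟩ := vecH_coords
  obtain ⟨b1, b2, b3⟩ := vecE_coords
  obtain ⟨c1, c2, c3⟩ := vecV_coords
  obtain ⟨d1, d2, d3⟩ := bracket_coords vecE vecH
  apply su2_ext <;> simp [*]
  ring

theorem bracket_vecV_vecH : bracket vecV vecH = vecE := by
  obtain ⟨a1, a2, a3⟩ := vecH_coords
  obtain ⟨b1, b2, b3⟩ := vecE_coords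
  obtain ⟨c1, c2, c3⟩ := vecV_coords
  obtain ⟨d1, d2, d3⟩ := bracket_coords vecV vecH
  apply su2_ext <;> simp [*]
  ring

theorem bracket_zero_left (x : su2) : bracket 0 x = 0 := by
  apply Subtype.ext
  simp [bracket]

theorem bracket_neg_self (x : su2) : bracket (-x) x = 0 := by
  apply Subtype.ext
  simp [bracket]

theorem theta_frame (t : ℝ) (i : Fin 6) : theta (γ t) (frame t i) = thetaFrame t i := by
  have h0 : theta (γ t) (velocity t) = (0, vecH) := by
    have h : dEmb (γ t) (velocity t) = _ := emb_velocity t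
    rw [theta_γ, h, map_zero]
  fin_cases i
  · exact h0
  · refine (theta_fundamental vecA t).trans ?_
    simp [vecA, bracket_neg_self, thetaFrame, two_smul]
  · refine (theta_fundamental vecE₁ t).trans ?_
    simp [vecE₁, bracket_zero_left, thetaFrame]
  · refine (theta_fundamental vecV₁ t).trans ?_
    simp [vecV₁, bracket_zero_left, thetaFrame]
  · refine (theta_fundamental vecE₂ t).trans ?_
    simp [vecE₂, bracket_vecE_vecH, thetaFrame]
  · refine (theta_fundamental vecV₂ t).trans ?_
    simp [vecV₂, bracket_vecV_vecH, thetaFrame]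

theorem coframe_frame (t : ℝ) (ht : t ≠ 0) (j i : Fin 6) :
    coframe t ht j (frame t i) = if i = j then 1 else 0 := by
  rw [coframe, ← coe_frameBasis t ht, Module.Basis.coord_apply, Module.Basis.repr_self,
    Finsupp.single_apply]

theorem theta_eq_sum_coframe (t : ℝ) (ht : t ≠ 0) (v : TangentSpace I (γ t)) :
    theta (γ t) v = ∑ j, coframe t ht j v • thetaFrame t j := by
  have h := (frameBasis t ht).sum_repr v
  rw [coe_frameBasis] at h
  nth_rw 1 [← h]
  refine (map_sum (theta (γ t)) _ _).trans (Finset.sum_congr rfl fun j _ => ?_)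
  rw [← theta_frame]
  exact (theta (γ t)).map_smul _ _

/-! ### Equivariant bilinear forms on `𝔰𝔲₂ ⊕ 𝔰𝔲₂` -/

/-- The triple product of imaginary quaternions. -/
def triple (u v w : su2) : ℝ := inner ℝ (u : ℍ[ℝ]) ((v : ℍ[ℝ]) * (w : ℍ[ℝ]))

theorem inner_su2 (u v : su2) : inner ℝ u v = (u : ℍ[ℝ]).imI * (v : ℍ[ℝ]).imI +
    (u : ℍ[ℝ]).imJ * (v : ℍ[ℝ]).imJ + (u : ℍ[ℝ]).imK * (v : ℍ[ℝ]).imK := by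
  change inner ℝ (u : ℍ[ℝ]) (v : ℍ[ℝ]) = _
  rw [Quaternion.inner_def, Quaternion.re_mul]
  simp [re_coe_su2]

theorem triple_eq (u v w : su2) : triple u v w =
    (u : ℍ[ℝ]).imI * ((v : ℍ[ℝ]).imJ * (w : ℍ[ℝ]).imK - (v : ℍ[ℝ]).imK * (w : ℍ[ℝ]).imJ) +
    (u : ℍ[ℝ]).imJ * ((v : ℍ[ℝ]).imK * (w : ℍ[ℝ]).imI - (v : ℍ[ℝ]).imI * (w : ℍ[ℝ]).imK) +
    (u : ℍ[ℝ]).imK * ((v : ℍ[ℝ]).imI * (w : ℍ[ℝ]).imJ - (v : ℍ[ℝ]).imJ * (w : ℍ[ℝ]).imI) := by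
  rw [triple, Quaternion.inner_def, Quaternion.re_mul]
  simp only [Quaternion.re_star, Quaternion.imI_star, Quaternion.imJ_star, Quaternion.imK_star,
    Quaternion.imI_mul, Quaternion.imJ_mul, Quaternion.imK_mul, re_coe_su2]
  ring

theorem inner_conj (b : SU2) (x y : ℍ[ℝ]) :
    inner ℝ ((b : ℍ[ℝ]) * x * star (b : ℍ[ℝ])) ((b : ℍ[ℝ]) * y * star (b : ℍ[ℝ])) =
      inner ℝ x y := by
  have hre : ∀ a c : ℍ[ℝ], (a * c).re = (c * a).re := fun a c => by
    simp only [Quaternion.re_mul]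
    ring
  have h : (b : ℍ[ℝ]) * x * star (b : ℍ[ℝ]) * star ((b : ℍ[ℝ]) * y * star (b : ℍ[ℝ])) =
      (b : ℍ[ℝ]) * ((x * star y) * star (b : ℍ[ℝ])) := by
    simp only [star_mul, star_star, mul_assoc]
    rw [← mul_assoc (star (b : ℍ[ℝ])) (b : ℍ[ℝ]), star_mul_self_sphere, one_mul]
  rw [Quaternion.inner_def, Quaternion.inner_def, h, hre, mul_assoc, star_mul_self_sphere, mul_one]

theorem inner_Ad (b : SU2) (u v : su2) : inner ℝ (Ad b u) (Ad b v) = inner ℝ u v := by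
  change inner ℝ (Ad b u : ℍ[ℝ]) (Ad b v : ℍ[ℝ]) = inner ℝ (u : ℍ[ℝ]) (v : ℍ[ℝ])
  rw [coe_Ad, coe_Ad, inner_conj]

theorem triple_Ad (b : SU2) (u v w : su2) : triple (Ad b u) (Ad b v) (Ad b w) = triple u v w := by
  have h : (Ad b v : ℍ[ℝ]) * (Ad b w : ℍ[ℝ]) =
      (b : ℍ[ℝ]) * ((v : ℍ[ℝ]) * (w : ℍ[ℝ])) * star (b : ℍ[ℝ]) := by
    rw [coe_Ad, coe_Ad]
    simp only [mul_assoc]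
    rw [← mul_assoc (star (b : ℍ[ℝ])) (b : ℍ[ℝ]), star_mul_self_sphere, one_mul]
  rw [triple, triple, h, coe_Ad, inner_conj]

/-- The general `SU₂`-equivariant alternating form at `v`, in terms of its five coefficients. -/
def modelForm (a c p q r : ℝ) (v : su2) : Bilin :=
  (LinearMap.mk₂ ℝ (fun z w : su2 × su2 =>
    a * triple v z.1 w.1 + c * triple v z.2 w.2 + p * (inner ℝ z.1 w.2 - inner ℝ w.1 z.2) +
      q * (inner ℝ v z.1 * inner ℝ v w.2 - inner ℝ v w.1 * inner ℝ v z.2) +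
      r * (triple v z.1 w.2 - triple v w.1 z.2))
    (fun x y z => by
      simp only [triple, Prod.fst_add, Prod.snd_add, Submodule.coe_add, add_mul, mul_add,
        inner_add_left, inner_add_right]
      ring)
    (fun x y z => by
      simp only [triple, Prod.smul_fst, Prod.smul_snd, Submodule.coe_smul, smul_mul_assoc,
        mul_smul_comm, inner_smul_left, inner_smul_right, smul_eq_mul, RCLike.conj_to_real]
      ring)
    (fun x y z => by
      simp only [triple, Prod.fst_add, Prod.snd_add, Submodule.coe_add, add_mul, mul_add,
        inner_add_left, inner_add_right]
      ring)
    (fun x y z => by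
      simp only [triple, Prod.smul_fst, Prod.smul_snd, Submodule.coe_smul, smul_mul_assoc,
        mul_smul_comm, inner_smul_left, inner_smul_right, smul_eq_mul, RCLike.conj_to_real]
      ring)).toContinuousBilinearMap

theorem modelForm_apply (a c p q r : ℝ) (v : su2) (z w : su2 × su2) :
    modelForm a c p q r v z w =
      a * triple v z.1 w.1 + c * triple v z.2 w.2 + p * (inner ℝ z.1 w.2 - inner ℝ w.1 z.2) +
      q * (inner ℝ v z.1 * inner ℝ v w.2 - inner ℝ v w.1 * inner ℝ v z.2) +
      r * (triple v z.1 w.2 - triple v w.1 z.2) := rfl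

theorem modelForm_self (a c p q r : ℝ) (v : su2) (z : su2 × su2) :
    modelForm a c p q r v z z = 0 := by
  rw [modelForm_apply]
  simp only [triple_eq]
  ring

theorem modelForm_zero (a c p q r : ℝ) (z w : su2 × su2) :
    modelForm a c p q r 0 z w = p * (inner ℝ z.1 w.2 - inner ℝ w.1 z.2) := by
  simp [modelForm_apply, triple]

theorem modelForm_Ad (a c p q r : ℝ) (b : SU2) (v : su2) (z w : su2 × su2) :
    modelForm a c p q r (Ad b v) (AdP b z) (AdP b w) = modelForm a c p q r v z w := by
  simp only [modelForm_apply, AdP_apply, inner_Ad, triple_Ad]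

theorem contDiff_modelForm {a c p q r : su2 → ℝ} (ha : ContDiff ℝ ∞ a) (hc : ContDiff ℝ ∞ c)
    (hp : ContDiff ℝ ∞ p) (hq : ContDiff ℝ ∞ q) (hr : ContDiff ℝ ∞ r) :
    ContDiff ℝ ∞ fun v => modelForm (a v) (c v) (p v) (q v) (r v) v := by
  rw [contDiff_clm_apply_iff]
  intro z
  rw [contDiff_clm_apply_iff]
  intro w
  have ht : ∀ x y : su2, ContDiff ℝ ∞ fun v => triple v x y := fun x y =>
    su2.subtypeL.contDiff.inner ℝ contDiff_const
  have hi : ∀ x : su2, ContDiff ℝ ∞ fun v : su2 => (inner ℝ v x : ℝ) := fun x =>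
    contDiff_id.inner ℝ contDiff_const
  simp only [modelForm_apply]
  exact ((((ha.mul (ht _ _)).add (hc.mul (ht _ _))).add (hp.mul contDiff_const)).add
    (hq.mul (((hi _).mul (hi _)).sub ((hi _).mul (hi _))))).add (hr.mul ((ht _ _).sub (ht _ _)))

/-- The factors `16, 8, -8, -16` absorb the lengths `‖vecH‖² = 1/4` and `‖vecE‖² = ‖vecV‖² = 1/8`.
The only relation needed beyond ring identities is `(1 / (2√2))² = 1/8`. -/
theorem modelForm_vecH (A C P Q R t : ℝ) (c d : Fin 6 → ℝ) :
    modelForm (16 * A) (16 * C) (8 * P) (-8 * Q) (-16 * R) (t • vecH)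
      (∑ j, c j • thetaFrame t j) (∑ j, d j • thetaFrame t j) =
    (t ^ 2 * Q - 4 * P) * (c 0 * d 1 - d 0 * c 1) + t * A * (c 2 * d 3 - d 2 * c 3) +
      (t ^ 3 * C + t * A - 2 * t * P) * (c 4 * d 5 - d 4 * c 5) +
      t ^ 2 * R * (c 2 * d 4 - d 2 * c 4 + (c 3 * d 5 - d 3 * c 5)) +
      (t * P - t * A) * (c 2 * d 5 - d 2 * c 5 - (c 3 * d 4 - d 3 * c 4)) := by
  obtain ⟨a1, a2, a3⟩ := vecH_coords
  obtain ⟨b1, b2, b3⟩ := vecE_coords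
  obtain ⟨c1, c2, c3⟩ := vecV_coords
  have hk : (1 / (2 * √2)) ^ 2 = (1 / 8 : ℝ) := by
    rw [div_pow, mul_pow, Real.sq_sqrt zero_le_two]
    norm_num
  generalize 1 / (2 * √2) = k at hk b2 c3
  rw [modelForm_apply]
  simp only [inner_su2, triple_eq, Fin.sum_univ_six, thetaFrame, Matrix.cons_val, Prod.fst_add,
    Prod.snd_add, Prod.smul_mk, Submodule.coe_add, Submodule.coe_smul, Submodule.coe_neg,
    Quaternion.imI_add, Quaternion.imJ_add, Quaternion.imK_add, Quaternion.imI_smul,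
    Quaternion.imJ_smul, Quaternion.imK_smul, Quaternion.imI_neg, Quaternion.imJ_neg,
    Quaternion.imK_neg, Submodule.coe_zero, Quaternion.imI_zero, Quaternion.imJ_zero,
    Quaternion.imK_zero, a1, a2, a3, b1, b2, b3, c1, c2, c3, smul_eq_mul]
  linear_combination (8 * A * t * ((c 2 - c 4) * (d 3 - d 5) - (c 3 - c 5) * (d 2 - d 4)) +
    8 * C * t ^ 3 * (c 4 * d 5 - c 5 * d 4) +
    8 * P * t * ((c 2 - c 4) * d 5 - (c 3 - c 5) * d 4 - (d 2 - d 4) * c 5 + (d 3 - d 5) * c 4) -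
    8 * R * t ^ 2 * (-(c 2 - c 4) * d 4 - (c 3 - c 5) * d 5 + (d 2 - d 4) * c 4 +
      (d 3 - d 5) * c 5)) * hk

/-! ### Coefficients of an invariant form along `γ` -/

/-- `Ω` has the coefficients `f₁, …, f₅` along `γ`. -/
def HasCoeffs (Ω : BilinField) (f₁ f₂ f₃ f₄ f₅ : ℝ → ℝ) : Prop :=
  ∀ (t : ℝ) (ht : t ≠ 0) (v w : TangentSpace I (γ t)),
    Ω (γ t) v w = f₁ t * form₁ t ht v w + f₂ t * form₂ t ht v w + f₃ t * form₃ t ht v w +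
      f₄ t * form₄ t ht v w + f₅ t * form₅ t ht v w

theorem toMatrix_thetaFrame (Ω : BilinField) (t : ℝ) (i j : Fin 6) :
    toMatrix Ω (γ t) (thetaFrame t i) (thetaFrame t j) = Ω (γ t) (frame t i) (frame t j) := by
  have h := toMatrix_theta Ω (γ t) (frame t i) (frame t j)
  rw [theta_frame, theta_frame] at h
  exact h

section Coeffs

variable {Ω : BilinField} {f₁ f₂ f₃ f₄ f₅ : ℝ → ℝ}

theorem HasCoeffs.eq_toMatrix (hf : HasCoeffs Ω f₁ f₂ f₃ f₄ f₅) {t : ℝ} (ht : t ≠ 0) :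
    f₁ t = toMatrix Ω (γ t) (thetaFrame t 0) (thetaFrame t 1) ∧
    f₂ t = toMatrix Ω (γ t) (thetaFrame t 2) (thetaFrame t 3) ∧
    f₃ t = toMatrix Ω (γ t) (thetaFrame t 4) (thetaFrame t 5) ∧
    f₄ t = toMatrix Ω (γ t) (thetaFrame t 2) (thetaFrame t 4) ∧
    f₅ t = toMatrix Ω (γ t) (thetaFrame t 2) (thetaFrame t 5) := by
  simp only [toMatrix_thetaFrame, hf t ht, form₁, form₂, form₃, form₄, form₅, wedge, coframe_frame]
  simp

theorem toMatrix_γ_eq_modelForm (hf : HasCoeffs Ω f₁ f₂ f₃ f₄ f₅) {t A C P Q R : ℝ} (ht : t ≠ 0)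
    (h1 : f₁ t = t ^ 2 * Q - 4 * P) (h2 : f₂ t = t * A)
    (h3 : f₃ t = t ^ 3 * C + t * A - 2 * t * P) (h4 : f₄ t = t ^ 2 * R)
    (h5 : f₅ t = t * P - t * A) (z w : su2 × su2) :
    toMatrix Ω (γ t) z w =
      modelForm (16 * A) (16 * C) (8 * P) (-8 * Q) (-16 * R) (t • vecH) z w := by
  obtain ⟨v, rfl⟩ := theta_surjective (γ t) z
  obtain ⟨u, rfl⟩ := theta_surjective (γ t) w
  have e : toMatrix Ω (γ t) (theta (γ t) v) (theta (γ t) u) = _ :=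
    (toMatrix_theta Ω (γ t) v u).trans (hf t ht v u)
  have ev := theta_eq_sum_coframe t ht v
  have eu := theta_eq_sum_coframe t ht u
  rw [e, ev, eu]
  refine Eq.trans ?_ (modelForm_vecH A C P Q R t (fun j => coframe t ht j v)
    (fun j => coframe t ht j u)).symm
  simp only [form₁, form₂, form₃, form₄, form₅, wedge, h1, h2, h3, h4, h5]

end Coeffs

/-- Makes the complement of `0` dense in `su2`, so that identities off `S` pass to `S` by
continuity. -/
instance : Nontrivial su2 := ⟨vecH, 0, vecH_ne_zero⟩

section Coeffs

variable {Ω Ω' : BilinField} {f₁ f₂ f₃ f₄ f₅ : ℝ → ℝ}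

/-- The conditions on the extensions `F₁, …, F₅` of the coefficients. -/
structure CoeffConditions (F₁ F₂ F₃ F₄ F₅ : ℝ → ℝ) : Prop where
  smooth₁ : ContDiff ℝ ∞ F₁
  smooth₂ : ContDiff ℝ ∞ F₂
  smooth₃ : ContDiff ℝ ∞ F₃
  smooth₄ : ContDiff ℝ ∞ F₄
  smooth₅ : ContDiff ℝ ∞ F₅
  even₁ : F₁.Even
  even₄ : F₄.Even
  odd₂ : F₂.Odd
  odd₃ : F₃.Odd
  odd₅ : F₅.Odd
  deriv₃ : deriv F₃ 0 = 1 / 2 * F₁ 0 + deriv F₂ 0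
  deriv₅ : deriv F₅ 0 = -(1 / 4) * F₁ 0 - deriv F₂ 0
  zero₄ : F₄ 0 = 0

/-! ### From coefficients to an invariant form -/

/-- Inverts the system of `modelForm_vecH`: `F₂ = tA`, `F₂ + F₅ = tP`, `F₂ + F₃ + 2F₅ = t³C`, `F₁ +
4P = t²Q`, `F₄ = t²R`. Oddness permits one division and evenness of the quotient makes its next one
odd; the relations at `0` remove the remaining constant terms. -/
theorem CoeffConditions.exists_model {F₁ F₂ F₃ F₄ F₅ : ℝ → ℝ}
    (hF : CoeffConditions F₁ F₂ F₃ F₄ F₅) (hinv : IsInvariantOn Ω Sᶜ)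
    (hf : HasCoeffs Ω f₁ f₂ f₃ f₄ f₅)
    (e₁ : ∀ t ≠ 0, F₁ t = f₁ t) (e₂ : ∀ t ≠ 0, F₂ t = f₂ t) (e₃ : ∀ t ≠ 0, F₃ t = f₃ t)
    (e₄ : ∀ t ≠ 0, F₄ t = f₄ t) (e₅ : ∀ t ≠ 0, F₅ t = f₅ t) :
    ∃ m : su2 → Bilin, ContDiff ℝ ∞ m ∧ (∀ v z, m v z z = 0) ∧
      (∀ z w, m 0 z w = -2 * F₁ 0 * (inner ℝ z.1 w.2 - inner ℝ w.1 z.2)) ∧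
      ∀ p ∈ Sᶜ, toMatrix Ω p = m (triv p).2 := by
  have d₂ : DifferentiableAt ℝ F₂ 0 := (hF.smooth₂.differentiable (by simp)).differentiableAt
  have d₃ : DifferentiableAt ℝ F₃ 0 := (hF.smooth₃.differentiable (by simp)).differentiableAt
  have d₅ : DifferentiableAt ℝ F₅ 0 := (hF.smooth₅.differentiable (by simp)).differentiableAt
  obtain ⟨A, hA, eA, -, evA, -⟩ := exists_contDiff_eq_mul hF.smooth₂ hF.odd₂.map_zero
  have o25 : (fun t => F₂ t + F₅ t).Odd := fun t => by
    simp only [hF.odd₂ t, hF.odd₅ t]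
    ring
  obtain ⟨P, hP, eP, P0, evP, -⟩ := exists_contDiff_eq_mul (hF.smooth₂.add hF.smooth₅) o25.map_zero
  have o235 : (fun t => F₂ t + F₃ t + 2 * F₅ t).Odd := fun t => by
    simp only [hF.odd₂ t, hF.odd₃ t, hF.odd₅ t]
    ring
  obtain ⟨C₁, hC₁, eC₁, C₁0, evC₁, -⟩ := exists_contDiff_eq_mul
    ((hF.smooth₂.add hF.smooth₃).add (contDiff_const.mul hF.smooth₅)) o235.map_zero
  have dP : P 0 = -(1 / 4) * F₁ 0 := by
    rw [P0, deriv_fun_add d₂ d₅, hF.deriv₅]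
    ring
  -- Both derivative relations enter: they cancel the linear term of `F₂ + F₃ + 2F₅`, which is then
  -- divisible by `t³`.
  have dC : C₁ 0 = 0 := by
    refine C₁0.trans (((d₂.hasDerivAt.add d₃.hasDerivAt).add
      (d₅.hasDerivAt.const_mul 2)).deriv.trans ?_)
    rw [hF.deriv₅, hF.deriv₃]
    ring
  obtain ⟨C₂, hC₂, eC₂, -, -, oddC₂⟩ := exists_contDiff_eq_mul hC₁ dC
  obtain ⟨C, hC, eC, -, evC, -⟩ := exists_contDiff_eq_mul hC₂ (oddC₂ (evC₁ o235)).map_zero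
  have ev1 : (fun t => F₁ t + 4 * P t).Even := fun t => by
    simp only [hF.even₁ t, evP o25 t]
  obtain ⟨Q₁, hQ₁, eQ₁, -, -, oddQ₁⟩ := exists_contDiff_eq_mul
    (hF.smooth₁.add (contDiff_const.mul hP) : ContDiff ℝ ∞ fun t => F₁ t + 4 * P t)
    (by rw [dP]; ring)
  obtain ⟨Q, hQ, eQ, -, evQ, -⟩ := exists_contDiff_eq_mul hQ₁ (oddQ₁ ev1).map_zero
  obtain ⟨R₁, hR₁, eR₁, -, -, oddR₁⟩ := exists_contDiff_eq_mul hF.smooth₄ hF.zero₄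
  obtain ⟨R, hR, eR, -, evR, -⟩ := exists_contDiff_eq_mul hR₁ (oddR₁ hF.even₄).map_zero
  -- The radial parameter is `2‖v‖` because `‖vecH‖ = 1/2`, so that `v = t • vecH` gives `|t|`.
  have hs : ∀ (k : ℝ) {g : ℝ → ℝ}, ContDiff ℝ ∞ g → g.Even →
      ContDiff ℝ ∞ fun v : su2 => k * g (2 * ‖v‖) := fun k g hg he =>
    contDiff_const.mul (contDiff_comp_norm (F := fun t => g (2 * t))
      (hg.comp (contDiff_const.mul contDiff_id)) fun t => by
        change g (2 * -t) = g (2 * t)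
        rw [mul_neg, he])
  refine ⟨_, contDiff_modelForm (hs 16 hA (evA hF.odd₂)) (hs 16 hC (evC (oddC₂ (evC₁ o235))))
    (hs 8 hP (evP o25)) (hs (-8) hQ (evQ (oddQ₁ ev1))) (hs (-16) hR (evR (oddR₁ hF.even₄))),
    fun v z => modelForm_self _ _ _ _ _ v z, fun z w => ?_, fun p hp => ?_⟩
  · rw [modelForm_zero, norm_zero, mul_zero, dP]
    ring
  -- Both sides are equivariant, so it suffices to compare them on `γ`.
  · obtain ⟨a, t, -, rfl, ht, hv⟩ := exists_smul_γ p
    have hv0 : (triv (a • γ t)).2 ≠ 0 := fun h => hp (mem_S_iff.2 h)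
    have ht0 : t ≠ 0 := by
      rw [ht]
      exact mul_ne_zero two_ne_zero (norm_ne_zero_iff.2 hv0)
    have hγ := toMatrix_γ_eq_modelForm hf ht0 (A := A t) (C := C t) (P := P t) (Q := Q t) (R := R t)
      (by rw [← e₁ t ht0]; linear_combination eQ₁ t + t * eQ t)
      (by rw [← e₂ t ht0]; exact eA t)
      (by rw [← e₃ t ht0]
          linear_combination eC₁ t + t * eC₂ t + t ^ 2 * eC t - 2 * eP t + eA t)
      (by rw [← e₄ t ht0]; linear_combination eR₁ t + t * eR t)
      (by rw [← e₅ t ht0]; linear_combination eP t - eA t)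
    refine ContinuousLinearMap.ext fun z' => ContinuousLinearMap.ext fun w' => ?_
    obtain ⟨z, rfl⟩ := AdP_surjective a.2 z'
    obtain ⟨w, rfl⟩ := AdP_surjective a.2 w'
    rw [toMatrix_smul hinv a (γ_mem_compl_S ht0), hγ, ← ht, ← hv, modelForm_Ad]

theorem isTwoFormOn_ofMatrix {m : su2 → Bilin} (hm : ContDiff ℝ ∞ m) (halt : ∀ v z, m v z z = 0) :
    IsTwoFormOn (ofMatrix fun p => m (triv p).2) Set.univ where
  alternating p _ v := halt _ (theta p v)
  smooth := by
    have h : ContMDiff I 𝓘(ℝ, su2) ∞ fun p : M => (triv p).2 := contMDiff_snd.comp contMDiff_triv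
    exact (contMDiff_ofMatrix (hm.comp_contMDiff h)).contMDiffOn

theorem ofMatrix_eq {β : M → Bilin} {p : M} (h : toMatrix Ω p = β p) : ofMatrix β p = Ω p := by
  refine ContinuousLinearMap.ext fun v => ContinuousLinearMap.ext fun w => ?_
  refine (ofMatrix_apply β p v w).trans ?_
  rw [← h]
  exact toMatrix_theta Ω p v w

theorem toMatrix_congr {p : M} (h : Ω' p = Ω p) : toMatrix Ω' p = toMatrix Ω p := by
  have h' : fiberForm Ω' p = fiberForm Ω p := h
  rw [toMatrix, toMatrix, h']

/-! ### From an extension to its coefficients -/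

theorem contDiff_toMatrix_fibre (hΩ' : IsTwoFormOn Ω' Set.univ) (x : SU2) :
    ContDiff ℝ ∞ fun v : su2 => toMatrix Ω' (triv.symm (x, v)) := by
  have h1 : ContMDiff 𝓘(ℝ, su2) I ∞ fun v : su2 => (x, v) :=
    contMDiff_const.prodMk contMDiff_id
  exact ((contMDiff_toMatrix hΩ').comp (contMDiff_triv_symm.comp h1)).contDiff

theorem contDiff_toMatrix_mk (hΩ' : IsTwoFormOn Ω' Set.univ) :
    ContDiff ℝ ∞ fun v : su2 => toMatrix Ω' (mk 1 v) :=
  contDiff_toMatrix_fibre hΩ' 1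

/-- Invariance is assumed only off `S`; equivariance at `v = 0` comes from continuity and density.
-/
theorem toMatrix_mk_Ad (hΩ' : IsTwoFormOn Ω' Set.univ) (hext : ∀ p ∈ Sᶜ, Ω' p = Ω p)
    (hinv : IsInvariantOn Ω Sᶜ) (b : SU2) (v : su2) (z w : su2 × su2) :
    toMatrix Ω' (mk 1 (Ad b v)) (AdP b z) (AdP b w) = toMatrix Ω' (mk 1 v) z w := by
  have hc := (contDiff_toMatrix_mk hΩ').continuous
  have h1 : Continuous fun v => toMatrix Ω' (mk 1 (Ad b v)) (AdP b z) (AdP b w) :=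
    ((hc.comp (AdL b).continuous).clm_apply continuous_const).clm_apply continuous_const
  have h2 : Continuous fun v => toMatrix Ω' (mk 1 v) z w :=
    (hc.clm_apply continuous_const).clm_apply continuous_const
  refine congrFun (h1.ext_on (dense_compl_singleton (0 : su2)) h2 fun u hu => ?_) v
  have hu' : mk 1 u ∈ Sᶜ := mk_one_mem_compl_S.2 hu
  have hb : mk 1 (Ad b u) ∈ Sᶜ := by
    refine mk_one_mem_compl_S.2 fun h => hu ?_
    have h3 := inner_Ad b u u
    rw [h, inner_zero_left] at h3
    exact inner_self_eq_zero.1 h3.symm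
  simp only
  rw [toMatrix_congr (hext _ hu'), toMatrix_congr (hext _ hb), ← mk_diag]
  exact toMatrix_smul hinv (b, b) hu' z w

/-- The Weyl group element, represented by `j`; it reverses `γ` and is the source of all parities.
-/
theorem exists_Ad_reflection :
    ∃ b : SU2, Ad b vecH = -vecH ∧ Ad b vecE = vecE ∧ Ad b vecV = -vecV := by
  obtain ⟨j, j0, j1, j2, j3⟩ : ∃ j : ℍ[ℝ], j.re = 0 ∧ j.imI = 0 ∧ j.imJ = 1 ∧ j.imK = 0 :=
    ⟨⟨0, 0, 1, 0⟩, rfl, rfl, rfl, rfl⟩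
  refine ⟨⟨j, ?_⟩, ?_, ?_, ?_⟩
  · rw [mem_sphere_zero_iff_norm, ← sq_eq_sq₀ (norm_nonneg _) zero_le_one, sq,
      ← Quaternion.normSq_eq_norm_mul_self, Quaternion.normSq_def', j0, j1, j2, j3]
    norm_num
  all_goals
    obtain ⟨a1, a2, a3⟩ := vecH_coords
    obtain ⟨b1, b2, b3⟩ := vecE_coords
    obtain ⟨c1, c2, c3⟩ := vecV_coords
    apply su2_ext <;> simp [coe_Ad, re_coe_su2, *]

theorem norm_sq_vec : ‖vecH‖ ^ 2 = 1 / 4 ∧ ‖vecE‖ ^ 2 = 1 / 8 ∧ ‖vecV‖ ^ 2 = 1 / 8 := by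
  obtain ⟨a1, a2, a3⟩ := vecH_coords
  obtain ⟨b1, b2, b3⟩ := vecE_coords
  obtain ⟨c1, c2, c3⟩ := vecV_coords
  have hk : (1 / (2 * √2)) * (1 / (2 * √2)) = (1 / 8 : ℝ) := by
    rw [← sq, div_pow, mul_pow, Real.sq_sqrt zero_le_two]
    norm_num
  refine ⟨?_, ?_, ?_⟩ <;> rw [← real_inner_self_eq_norm_sq, inner_su2]
  · rw [a1, a2, a3]; norm_num
  · rw [b1, b2, b3, hk]; norm_num
  · rw [c1, c2, c3, hk]; norm_num

theorem hasDerivAt_id_mul {g : ℝ → ℝ} (hg : ContDiff ℝ ∞ g) :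
    HasDerivAt (fun t => t * g t) (g 0) 0 := by
  have h := (hasDerivAt_id (0 : ℝ)).mul
    ((hg.differentiable (by simp)).differentiableAt (x := 0)).hasDerivAt
  have h1 : HasDerivAt (id * g) (g 0) 0 := by simpa using h
  exact h1

/-- Each coefficient is an entry of the smooth matrix along `γ` in `thetaFrame`, which is polynomial
in `t`. It thus becomes a polynomial in `t` and in six entries for constant vectors, whose parities
and values at `0` give all conditions. -/
theorem exists_coeffConditions (hΩ' : IsTwoFormOn Ω' Set.univ) (hext : ∀ p ∈ Sᶜ, Ω' p = Ω p)
    (hinv : IsInvariantOn Ω Sᶜ) (hf : HasCoeffs Ω f₁ f₂ f₃ f₄ f₅) :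
    ∃ F₁ F₂ F₃ F₄ F₅ : ℝ → ℝ, CoeffConditions F₁ F₂ F₃ F₄ F₅ ∧ (∀ t ≠ 0, F₁ t = f₁ t) ∧
      (∀ t ≠ 0, F₂ t = f₂ t) ∧ (∀ t ≠ 0, F₃ t = f₃ t) ∧ (∀ t ≠ 0, F₄ t = f₄ t) ∧
      (∀ t ≠ 0, F₅ t = f₅ t) := by
  let B : ℝ → Bilin := fun t => toMatrix Ω' (γ t)
  have hB : ContDiff ℝ ∞ B :=
    (contDiff_toMatrix_mk hΩ').comp (contDiff_id.smul contDiff_const)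
  have hBzw : ∀ z w, ContDiff ℝ ∞ fun t => B t z w := fun z w =>
    (hB.clm_apply contDiff_const).clm_apply contDiff_const
  have hself : ∀ t z, B t z z = 0 := fun t z => hΩ'.alternating (γ t) (Set.mem_univ _) _
  have hanti : ∀ t z w, B t z w = -B t w z := by
    intro t z w
    have h := hself t (z + w)
    simp only [map_add, add_apply, hself] at h
    linarith
  obtain ⟨b, bH, bE, bV⟩ := exists_Ad_reflection
  have b0 : Ad b 0 = 0 := (AdL b).map_zero
  have hrefl : ∀ t z w, B (-t) (AdP b z) (AdP b w) = B t z w := by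
    intro t z w
    have h := toMatrix_mk_Ad hΩ' hext hinv b (t • vecH) z w
    have h1 : Ad b (t • vecH) = (-t) • vecH := by
      rw [neg_smul, ← smul_neg, ← bH]
      exact (AdL b).map_smul t vecH
    rwa [h1] at h
  -- All of `SU₂` fixes `v = 0` and acts transitively on spheres, so this quadratic form in `x` is a
  -- multiple of `‖x‖²`.
  have hscale : ∀ x : su2, B 0 (x, 0) (0, x) = (2 * ‖x‖) ^ 2 * B 0 (vecH, 0) (0, vecH) := by
    intro x
    obtain ⟨c, hc⟩ := exists_Ad_smul_vecH x
    have h := toMatrix_mk_Ad hΩ' hext hinv c ((0 : ℝ) • vecH) ((2 * ‖x‖) • (vecH, 0))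
      ((2 * ‖x‖) • (0, vecH))
    have h0 : Ad c 0 = 0 := (AdL c).map_zero
    simp only [AdP_apply, Prod.smul_mk, smul_zero, hc, h0, zero_smul] at h
    have e : mk 1 0 = γ 0 := by rw [γ, zero_smul]
    have e1 : ((2 * ‖x‖) • vecH, (0 : su2)) = (2 * ‖x‖) • (vecH, (0 : su2)) := by simp
    have e2 : ((0 : su2), (2 * ‖x‖) • vecH) = (2 * ‖x‖) • ((0 : su2), vecH) := by simp
    rw [e, e1, e2] at h
    simp only [map_smul, smul_apply, smul_eq_mul] at h
    change toMatrix Ω' (γ 0) _ _ = _ * toMatrix Ω' (γ 0) _ _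
    rw [h]
    ring
  obtain ⟨-, nE, nV⟩ := norm_sq_vec
  let g₀ : ℝ → ℝ := fun t => B t (0, vecH) (vecH, 0)
  let g₁ : ℝ → ℝ := fun t => B t (vecE, 0) (vecV, 0)
  let g₂ : ℝ → ℝ := fun t => B t (vecE, 0) (0, vecE)
  let g₃ : ℝ → ℝ := fun t => B t (0, vecV) (vecV, 0)
  let g₄ : ℝ → ℝ := fun t => B t (0, vecV) (0, vecE)
  let g₅ : ℝ → ℝ := fun t => B t (vecE, 0) (0, vecV)
  have s₀ : ContDiff ℝ ∞ g₀ := hBzw _ _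
  have s₁ : ContDiff ℝ ∞ g₁ := hBzw _ _
  have s₂ : ContDiff ℝ ∞ g₂ := hBzw _ _
  have s₃ : ContDiff ℝ ∞ g₃ := hBzw _ _
  have s₄ : ContDiff ℝ ∞ g₄ := hBzw _ _
  have s₅ : ContDiff ℝ ∞ g₅ := hBzw _ _
  have neg1 : ∀ x : su2, ((-x, 0) : su2 × su2) = -(x, 0) := fun x => by simp
  have neg2 : ∀ x : su2, ((0, -x) : su2 × su2) = -(0, x) := fun x => by simp
  have p₀ : ∀ t, g₀ (-t) = g₀ t := fun t => by
    have h := hrefl t (0, vecH) (vecH, 0)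
    simp only [AdP_apply, b0, bH, neg1, neg2, map_neg, neg_apply, neg_neg] at h
    exact h
  have p₁ : ∀ t, g₁ (-t) = -g₁ t := fun t => by
    have h := hrefl t (vecE, 0) (vecV, 0)
    simp only [AdP_apply, b0, bE, bV, neg1, map_neg] at h
    exact neg_eq_iff_eq_neg.1 h
  have p₂ : ∀ t, g₂ (-t) = g₂ t := fun t => by
    have h := hrefl t (vecE, 0) (0, vecE)
    simpa [b0, bE] using h
  have p₃ : ∀ t, g₃ (-t) = g₃ t := fun t => by
    have h := hrefl t (0, vecV) (vecV, 0)
    simp only [AdP_apply, b0, bV, neg1, neg2, map_neg, neg_apply, neg_neg] at h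
    exact h
  have p₄ : ∀ t, g₄ (-t) = -g₄ t := fun t => by
    have h := hrefl t (0, vecV) (0, vecE)
    simp only [AdP_apply, b0, bE, bV, neg2, map_neg, neg_apply] at h
    exact neg_eq_iff_eq_neg.1 h
  have p₅ : ∀ t, g₅ (-t) = -g₅ t := fun t => by
    have h := hrefl t (vecE, 0) (0, vecV)
    simp only [AdP_apply, b0, bE, bV, neg2, map_neg] at h
    exact neg_eq_iff_eq_neg.1 h
  have z₂ : g₂ 0 = -(1 / 2) * g₀ 0 := by
    have h := hscale vecE
    rw [mul_pow, nE, hanti 0 (vecH, 0)] at h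
    linear_combination h
  have z₃ : g₃ 0 = 1 / 2 * g₀ 0 := by
    have h := hscale vecV
    rw [mul_pow, nV, hanti 0 (vecH, 0), hanti 0 (vecV, 0)] at h
    linear_combination -h
  have dt : ∀ {g : ℝ → ℝ}, ContDiff ℝ ∞ g → HasDerivAt g (deriv g 0) 0 := fun hg =>
    ((hg.differentiable (by simp)).differentiableAt (x := 0)).hasDerivAt
  have hE : ∀ t, thetaFrame t 4 = -(vecE, 0) - t • (0, vecV) := fun t => by simp [thetaFrame]
  have hV : ∀ t, thetaFrame t 5 = -(vecV, 0) + t • (0, vecE) := fun t => by simp [thetaFrame]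
  have hH : ∀ t, thetaFrame t 1 = (2 : ℝ) • (vecH, 0) := fun t => by simp [thetaFrame]
  -- These are the expansions of the frame entries by bilinearity; the `2` in front of `g₀` comes
  -- from `Â ↦ (2 vecH, 0)`, and the factor `t` in the fourth gives its vanishing at `0`.
  refine ⟨fun t => 2 * g₀ t, g₁, fun t => g₁ t - t * g₂ t + t * g₃ t - t * (t * g₄ t),
    fun t => -(t * g₅ t), fun t => -g₁ t + t * g₂ t, ⟨?_, s₁, ?_, ?_, ?_, ?_, ?_, p₁, ?_, ?_, ?_,
    ?_, ?_⟩, ?_, ?_, ?_, ?_, ?_⟩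
  · exact contDiff_const.mul s₀
  · exact ((s₁.sub (contDiff_id.mul s₂)).add (contDiff_id.mul s₃)).sub
      (contDiff_id.mul (contDiff_id.mul s₄))
  · exact (contDiff_id.mul s₅).neg
  · exact s₁.neg.add (contDiff_id.mul s₂)
  · intro t
    simp only [p₀]
  · intro t
    simp only [p₅]
    ring
  · intro t
    simp only [p₁, p₂, p₃, p₄]
    ring
  · intro t
    simp only [p₁, p₂]
    ring
  · have h := (((dt s₁).sub (hasDerivAt_id_mul s₂)).add (hasDerivAt_id_mul s₃)).sub
      (hasDerivAt_id_mul (contDiff_id.mul s₄))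
    refine h.deriv.trans ?_
    simp only [z₂, z₃, id, zero_mul]
    ring
  · have h := (dt s₁).neg.add (hasDerivAt_id_mul s₂)
    refine h.deriv.trans ?_
    rw [z₂]
    ring
  · simp
  · intro t ht
    rw [(hf.eq_toMatrix ht).1, ← toMatrix_congr (hext _ (γ_mem_compl_S ht)), hH, map_smul]
    rfl
  · intro t ht
    rw [(hf.eq_toMatrix ht).2.1, ← toMatrix_congr (hext _ (γ_mem_compl_S ht))]
    rfl
  · intro t ht
    rw [(hf.eq_toMatrix ht).2.2.1, ← toMatrix_congr (hext _ (γ_mem_compl_S ht)), hE, hV]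
    simp only [map_add, map_sub, map_neg, map_smul, sub_apply,
      neg_apply, smul_apply, smul_eq_mul]
    simp only [g₁, g₂, g₃, g₄, B]
    ring
  · intro t ht
    rw [(hf.eq_toMatrix ht).2.2.2.1, ← toMatrix_congr (hext _ (γ_mem_compl_S ht)), hE]
    have h := hself t (vecE, 0)
    change _ = B t (vecE, 0) _
    rw [map_sub, map_neg, map_smul, h, neg_zero, zero_sub, smul_eq_mul]
  · intro t ht
    rw [(hf.eq_toMatrix ht).2.2.2.2, ← toMatrix_congr (hext _ (γ_mem_compl_S ht)), hV]
    change _ = B t (vecE, 0) _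
    rw [map_add, map_neg, map_smul, smul_eq_mul]

/-- An extension is determined by the model form. -/
theorem toMatrix_eq_of_extends (hΩ' : IsTwoFormOn Ω' Set.univ) (hext : ∀ p ∈ Sᶜ, Ω' p = Ω p)
    {m : su2 → Bilin} (hm : ContDiff ℝ ∞ m) (h : ∀ p ∈ Sᶜ, toMatrix Ω p = m (triv p).2) (p : M) :
    toMatrix Ω' p = m (triv p).2 := by
  have h1 : (fun v => toMatrix Ω' (triv.symm ((triv p).1, v))) = m := by
    refine (contDiff_toMatrix_fibre hΩ' (triv p).1).continuous.ext_on
      (dense_compl_singleton (0 : su2)) hm.continuous fun u hu => ?_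
    have hu' : triv.symm ((triv p).1, u) ∈ Sᶜ := by
      rw [Set.mem_compl_iff, mem_S_iff, triv.apply_symm_apply]
      exact hu
    simp only
    rw [toMatrix_congr (hext _ hu'), h _ hu', triv.apply_symm_apply]
  have h2 := congrFun h1 (triv p).2
  simpa using h2

end Coeffs

/-! ### Nondegeneracy along the singular orbit -/

/-- The sign of the standard symplectic form on pairs of indices. -/
def symplecticSign (a b : Fin 6) : ℤ :=
  if b.val = a.val + 1 ∧ a.val % 2 = 0 then 1
  else if a.val = b.val + 1 ∧ b.val % 2 = 0 then -1 else 0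

set_option maxRecDepth 100000 in
-- Only permutations preserving the three pairs contribute, each with `+1`: `3!` orders of the pairs
-- times `2³` swaps inside them.
theorem sum_sign_mul_symplecticSign : ∑ σ : Equiv.Perm (Fin 6), (Equiv.Perm.sign σ : ℤ) *
    (symplecticSign (σ 0) (σ 1) * symplecticSign (σ 2) (σ 3) * symplecticSign (σ 4) (σ 5)) =
      48 := by
  decide +kernel

theorem cube_eq_of_symplectic {T : Type*} [AddCommGroup T] [Module ℝ T] [TopologicalSpace T]
    {Ω : T →L[ℝ] T →L[ℝ] ℝ} {v : Fin 6 → T} {k : ℝ}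
    (h : ∀ a b, Ω (v a) (v b) = k * symplecticSign a b) : cube Ω v = 6 * k ^ 3 := by
  have h1 := congrArg (fun n : ℤ => (n : ℝ)) sum_sign_mul_symplecticSign
  simp only [Int.cast_sum, Int.cast_mul] at h1
  have h2 : cube Ω v = 1 / 8 * (k ^ 3 * ((48 : ℤ) : ℝ)) := by
    rw [cube, ← h1, Finset.mul_sum _ _ (k ^ 3)]
    congr 1
    refine Finset.sum_congr rfl fun σ _ => ?_
    rw [h, h, h]
    ring
  rw [h2]
  push_cast
  ring

/-- The imaginary units. -/
def unitVec (i : Fin 3) : su2 := ![⟨⟨0, 1, 0, 0⟩, rfl⟩, ⟨⟨0, 0, 1, 0⟩, rfl⟩, ⟨⟨0, 0, 0, 1⟩, rfl⟩] i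

theorem inner_unitVec (i j : Fin 3) :
    inner ℝ (unitVec i) (unitVec j) = if i = j then (1 : ℝ) else 0 := by
  rw [inner_su2]
  fin_cases i <;> fin_cases j <;> simp [unitVec]

section Orbit

variable {Ω : BilinField} {m : su2 → Bilin} {k : ℝ}

theorem apply_of_mem_S (hm : ∀ p, toMatrix Ω p = m (triv p).2)
    (h0 : ∀ z w, m 0 z w = k * (inner ℝ z.1 w.2 - inner ℝ w.1 z.2)) {p : M} (hp : p ∈ S)
    (v w : E) :
    fiberForm Ω p v w =
      k * (inner ℝ (theta p v).1 (theta p w).2 - inner ℝ (theta p w).1 (theta p v).2) := by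
  rw [← toMatrix_theta, hm, mem_S_iff.1 hp, h0]

theorem γ_zero_mem_S : γ 0 ∈ S := MulAction.mem_orbit_self _

theorem exists_cube_ne_zero_iff (hm : ∀ p, toMatrix Ω p = m (triv p).2)
    (h0 : ∀ z w, m 0 z w = k * (inner ℝ z.1 w.2 - inner ℝ w.1 z.2)) :
    (∃ v, cube (Ω (γ 0)) v ≠ 0) ↔ k ≠ 0 := by
  have hΩ := apply_of_mem_S hm h0 γ_zero_mem_S
  change (∃ v : Fin 6 → E, cube (fiberForm Ω (γ 0)) v ≠ 0) ↔ k ≠ 0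
  constructor
  · rintro ⟨v, hv⟩ rfl
    exact hv (by simp [cube, hΩ])
  · intro hk
    -- A Darboux basis, interleaved so that conjugate vectors are adjacent as in `symplecticSign`.
    let z : Fin 6 → su2 × su2 := ![(unitVec 0, 0), (0, unitVec 0), (unitVec 1, 0), (0, unitVec 1),
      (unitVec 2, 0), (0, unitVec 2)]
    refine ⟨fun i => (thetaEquiv (γ 0)).symm (z i), ?_⟩
    rw [cube_eq_of_symplectic (k := k)]
    · exact mul_ne_zero (by norm_num) (pow_ne_zero 3 hk)
    · intro a b
      refine (hΩ _ _).trans ?_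
      simp only [theta_thetaEquiv_symm]
      congr 1
      fin_cases a <;> fin_cases b <;> 
        simp [z, inner_unitVec, symplecticSign, -Submodule.coe_inner, -inner_self_eq_norm_sq_to_K]

theorem forall_isNondegenerate_iff (hm : ∀ p, toMatrix Ω p = m (triv p).2)
    (h0 : ∀ z w, m 0 z w = k * (inner ℝ z.1 w.2 - inner ℝ w.1 z.2)) :
    (∀ p ∈ S, IsNondegenerate (Ω p)) ↔ k ≠ 0 := by
  constructor
  · rintro h rfl
    have h1 := h _ γ_zero_mem_S ((thetaEquiv (γ 0)).symm (vecH, 0)) fun w =>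
      (apply_of_mem_S hm h0 γ_zero_mem_S _ w).trans (zero_mul _)
    have h2 := congrArg (theta (γ 0)) h1
    have h3 : theta (γ 0) (0 : E) = 0 := map_zero _
    rw [theta_thetaEquiv_symm] at h2
    exact vecH_ne_zero (congrArg Prod.fst (h2.trans h3))
  · intro hk p hp v hv
    have hz : ∀ z : su2 × su2,
        (inner ℝ (theta p v).1 z.2 : ℝ) - inner ℝ z.1 (theta p v).2 = 0 := by
      intro z
      obtain ⟨w, rfl⟩ := theta_surjective p z
      have h := apply_of_mem_S hm h0 hp v w
      rw [show fiberForm Ω p v w = 0 from hv w] at h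
      exact (mul_eq_zero.1 h.symm).resolve_left hk
    -- Pairing with the components of `theta p v`, placed in the opposite summands, produces their
    -- squared norms.
    have h1 := hz (0, (theta p v).1)
    have h2 := hz ((theta p v).2, 0)
    simp only [inner_zero_left, inner_zero_right, sub_zero, zero_sub, neg_eq_zero,
      inner_self_eq_zero] at h1 h2
    have h3 : theta p v = 0 := Prod.ext h1 h2
    exact (map_eq_zero_iff (thetaEquiv p) (thetaEquiv p).injective).1 h3

end Orbit

end CohomOne
end

/-! ### The extension theorem -/

theorem proposition6p1
    (Ω : CohomOne.BilinField) (f₁ f₂ f₃ f₄ f₅ : ℝ → ℝ)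
    (hΩ : CohomOne.IsTwoFormOn Ω CohomOne.Sᶜ)
    (hinv : CohomOne.IsInvariantOn Ω CohomOne.Sᶜ)
    (hf : ∀ (t : ℝ) (ht : t ≠ 0) (v w : TangentSpace CohomOne.I (CohomOne.γ t)),
      Ω (CohomOne.γ t) v w =
        f₁ t * CohomOne.form₁ t ht v w + f₂ t * CohomOne.form₂ t ht v w +
        f₃ t * CohomOne.form₃ t ht v w + f₄ t * CohomOne.form₄ t ht v w +
        f₅ t * CohomOne.form₅ t ht v w) :
    ((∃ Ω' : CohomOne.BilinField, CohomOne.IsTwoFormOn Ω' Set.univ ∧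
        ∀ p ∈ CohomOne.Sᶜ, Ω' p = Ω p) ↔
      ∃ F₁ F₂ F₃ F₄ F₅ : ℝ → ℝ,
        (CohomOne.SmoothlyExtends f₁ F₁ ∧ CohomOne.SmoothlyExtends f₂ F₂ ∧
          CohomOne.SmoothlyExtends f₃ F₃ ∧ CohomOne.SmoothlyExtends f₄ F₄ ∧
          CohomOne.SmoothlyExtends f₅ F₅) ∧
        (F₁.Even ∧ F₄.Even ∧ F₂.Odd ∧ F₃.Odd ∧ F₅.Odd) ∧
        (F₂ 0 = 0 ∧ F₃ 0 = 0 ∧ F₅ 0 = 0) ∧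
        deriv F₃ 0 = 1 / 2 * F₁ 0 + deriv F₂ 0 ∧
        deriv F₅ 0 = -(1 / 4) * F₁ 0 - deriv F₂ 0 ∧
        F₄ 0 = 0) ∧
    (∀ (Ω' : CohomOne.BilinField) (F₁ : ℝ → ℝ), CohomOne.IsTwoFormOn Ω' Set.univ →
      (∀ p ∈ CohomOne.Sᶜ, Ω' p = Ω p) → CohomOne.SmoothlyExtends f₁ F₁ →
        ((∃ v, CohomOne.cube (Ω' (CohomOne.γ 0)) v ≠ 0) ↔ F₁ 0 ≠ 0) ∧
        ((∀ p ∈ CohomOne.S, CohomOne.IsNondegenerate (Ω' p)) ↔ F₁ 0 ≠ 0)) := by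
  have hf' : CohomOne.HasCoeffs Ω f₁ f₂ f₃ f₄ f₅ := hf
  refine ⟨⟨?_, ?_⟩, ?_⟩
  · rintro ⟨Ω', hΩ', hext⟩
    obtain ⟨F₁, F₂, F₃, F₄, F₅, hF, e₁, e₂, e₃, e₄, e₅⟩ :=
      CohomOne.exists_coeffConditions hΩ' hext hinv hf'
    exact ⟨F₁, F₂, F₃, F₄, F₅, ⟨⟨hF.smooth₁, e₁⟩, ⟨hF.smooth₂, e₂⟩, ⟨hF.smooth₃, e₃⟩,
      ⟨hF.smooth₄, e₄⟩, ⟨hF.smooth₅, e₅⟩⟩, ⟨hF.even₁, hF.even₄, hF.odd₂, hF.odd₃, hF.odd₅⟩,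
      ⟨hF.odd₂.map_zero, hF.odd₃.map_zero, hF.odd₅.map_zero⟩, hF.deriv₃, hF.deriv₅, hF.zero₄⟩
  · rintro ⟨F₁, F₂, F₃, F₄, F₅, ⟨⟨s₁, e₁⟩, ⟨s₂, e₂⟩, ⟨s₃, e₃⟩, ⟨s₄, e₄⟩, ⟨s₅, e₅⟩⟩,
      ⟨ev₁, ev₄, o₂, o₃, o₅⟩, -, d₃, d₅, z₄⟩
    have hF : CohomOne.CoeffConditions F₁ F₂ F₃ F₄ F₅ :=
      ⟨s₁, s₂, s₃, s₄, s₅, ev₁, ev₄, o₂, o₃, o₅, d₃, d₅, z₄⟩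
    obtain ⟨m, hm, halt, -, h⟩ := hF.exists_model hinv hf' e₁ e₂ e₃ e₄ e₅
    exact ⟨_, CohomOne.isTwoFormOn_ofMatrix hm halt, fun p hp => CohomOne.ofMatrix_eq (h p hp)⟩
  · rintro Ω' F hΩ' hext ⟨hFs, hFe⟩
    obtain ⟨F₁, F₂, F₃, F₄, F₅, hF, e₁, e₂, e₃, e₄, e₅⟩ :=
      CohomOne.exists_coeffConditions hΩ' hext hinv hf'
    obtain ⟨m, hm, -, h0, h⟩ := hF.exists_model hinv hf' e₁ e₂ e₃ e₄ e₅
    -- A continuous extension of `f₁` across `0` is unique, so the given one has the value at `0`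
    -- that enters the model form.
    have hFF : F = F₁ := hFs.continuous.ext_on (dense_compl_singleton (0 : ℝ))
      hF.smooth₁.continuous fun t ht => (hFe t ht).trans (e₁ t ht).symm
    have hm' := CohomOne.toMatrix_eq_of_extends hΩ' hext hm h
    have hk : -2 * F₁ 0 ≠ 0 ↔ F₁ 0 ≠ 0 := by simp
    rw [hFF, ← hk]
    exact ⟨CohomOne.exists_cube_ne_zero_iff hm' h0, CohomOne.forall_isNondegenerate_iff hm' h0⟩
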